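/- Let $R$ be a (not necessarily commutative) ring; $\otimes$ means $\otimes_R$ and modules are left $R$-modules. A 2-fold bimodule $\Lambda=\Lambda_{1,2}$ is a left $R$-module with two right $R$-module structures $x\odot_1 r$ and $x\odot_2 r$ such that all three actions commute. Subscripts name the right actions by position: in $\Lambda_{B,A}$ the letter $B$ names $\odot_1$ and $A$ names $\odot_2$. When a subscript is the name of a module or bimodule that occurs as another tensor factor, that right action is the one used to tensor with the left action of this factor; the remaining letters name the remaining right actions, and a map of such objects is a left $R$-linear map carrying each right action to the right action with the same letter. $R_B$ is $R$ with its right multiplication. Fix a 2-fold bimodule $\Lambda$ and let $A\wedge B=\Lambda_{B,A}\otimes A\otimes B$, a bifunctor on left $R$-modules, so that $(x\odot_1 r)\otimes y\otimes z=x\otimes y\otimes rz$ and $(x\odot_2 r)\otimes y\otimes z=x\otimes ry\otimes z$. There is a one-to-one correspondence between the additive closed symmetric monoidal structures on the category of $R$-modules with $-\wedge-$ as the monoidal product (closedness being a property, namely that the functors $A\wedge-$ have right adjoints) and the following data: (a) an associativity isomorphism $a\colon \Lambda_{C,\Lambda}\otimes\Lambda_{B,A}\to\Lambda_{\Lambda,A}\otimes\Lambda_{C,B}$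 (of left modules, carrying each of the three right actions $A,B,C$ to the one with the same name); (b) a left $R$-module $K$ and a unit isomorphism of bimodules $\ell\colon\Lambda_{B,K}\otimes K\to R_B$; (c) a commutativity isomorphism $c\colon\Lambda_{B,A}\to\Lambda_{A,B}$, that is, a left linear bijection $c\colon\Lambda\to\Lambda$ with $c(x\odot_1 r)=c(x)\odot_2 r$ and $c(x\odot_2 r)=c(x)\odot_1 r$; subject to the following conditions, in which $\Gamma=\Delta=\Lambda$. (1) (Pentagon) The composites $$\Lambda_{D,\Gamma}\otimes\Gamma_{C,\Delta}\otimes\Delta_{B,A}\xrightarrow{a\otimes 1}\Lambda_{\Gamma,\Delta}\otimes\Gamma_{D,C}\otimes\Delta_{B,A}\xrightarrow{1\otimes T}\Lambda_{\Delta,\Gamma}\otimes\Gamma_{B,A}\otimes\Delta_{D,C}\xrightarrow{a\otimes1}\Lambda_{\Gamma,A}\otimes\Gamma_{\Delta,B}\otimes\Delta_{D,C}$$ and $$\Lambda_{D,\Gamma}\otimes\Gamma_{C,\Delta}\otimes\Delta_{B,A}\xrightarrow{1\otimes a}\Lambda_{D,\Gamma}\otimes\Gamma_{\Delta,A}\otimes\Delta_{C,B}\xrightarrow{a\otimes1}\Lambda_{\Gamma,A}\otimes\Gamma_{D,\Delta}\otimes\Delta_{C,B}\xrightarrow{1\otimes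 a}\Lambda_{\Gamma,A}\otimes\Gamma_{\Delta,B}\otimes\Delta_{D,C}$$ are equal, where $1\otimes T$ interchanges the last two tensor factors (and the names $\Gamma$, $\Delta$). (2) (Compatibility of left and right unit) The composites $$\Lambda_{B,\Lambda}\otimes\Lambda_{K,A}\otimes K\xrightarrow{a\otimes1}\Lambda_{\Lambda,A}\otimes\Lambda_{B,K}\otimes K\xrightarrow{1\otimes\ell}\Lambda_{B,A}$$ and $$\Lambda_{B,\Lambda}\otimes\Lambda_{K,A}\otimes K\xrightarrow{1\otimes c\otimes1}\Lambda_{B,\Lambda}\otimes\Lambda_{A,K}\otimes K\xrightarrow{1\otimes\ell}\Lambda_{B,A}$$ are equal. (3) (Hexagon) The composites $$\Lambda_{C,\Lambda}\otimes\Lambda_{B,A}\xrightarrow{1\otimes c}\Lambda_{C,\Lambda}\otimes\Lambda_{A,B}\xrightarrow{a}\Lambda_{\Lambda,B}\otimes\Lambda_{C,A}\xrightarrow{1\otimes c}\Lambda_{\Lambda,B}\otimes\Lambda_{A,C}$$ and $$\Lambda_{C,\Lambda}\otimes\Lambda_{B,A}\xrightarrow{a}\Lambda_{\Lambda,A}\otimes\Lambda_{C,B}\xrightarrow{c\otimes1}\Lambda_{A,\Lambda}\otimes\Lambda_{C,B}\xrightarrow{a}\Lambda_{\Lambda,B}\otimes\Lambda_{A,C}$$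 are equal. (4) The composite $\Lambda_{B,A}\xrightarrow{c}\Lambda_{A,B}\xrightarrow{c}\Lambda_{B,A}$ is the identity. In this correspondence a structure and the data $(a,K,\ell,c)$ belong to each other exactly when, up to the usual associativity and commutativity isomorphisms of $\otimes$, the associativity isomorphism $(A\wedge B)\wedge C\cong A\wedge(B\wedge C)$ is $a\otimes1\otimes1\otimes1$, the unit is $K$, the left unit isomorphism $K\wedge B\cong B$ sends $x\otimes k\otimes y$ to $\ell(x\otimes k)\,y$, and the commutativity isomorphism $A\wedge B\cong B\wedge A$ sends $x\otimes y\otimes z$ to $c(x)\otimes z\otimes y$. -/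

import Mathlib

open CategoryTheory MulOpposite
open scoped TensorProduct

universe u v w

noncomputable section

/-! ## Modules with commuting right actions, and the tensor product over a noncommutative ring -/

namespace NFold

section Basic

variable {R : Type u} [Ring R]

/-- A right `R`-action on a left `R`-module `M`, by left `R`-linear maps.
If `ρ` is such an action, then `ρ (op r) x` is `x ⊙ r`. -/
abbrev RightAct (R : Type u) [Ring R] (M : Type v) [AddCommGroup M] [Module R M] : Type (max u v) :=
  Rᵐᵒᵖ →+* Module.End R M

/-- Two right actions on the same left module commute. -/
def Commuting {M : Type v} [AddCommGroup M] [Module R M] (ρ σ : RightAct R M) : Prop :=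
  ∀ (r s : Rᵐᵒᵖ) (x : M), ρ r (σ s x) = σ s (ρ r x)

/-- The left linear map `f` carries the right action `ρ` to the right action `ρ'`:
`f (x ⊙ r) = f x ⊙' r`. -/
def Carries {M : Type v} [AddCommGroup M] [Module R M] {M' : Type w} [AddCommGroup M'] [Module R M']
    (f : M →ₗ[R] M') (ρ : RightAct R M) (ρ' : RightAct R M') : Prop :=
  ∀ (r : Rᵐᵒᵖ) (x : M), f (ρ r x) = ρ' r (f x)

lemma Commuting.carries {M : Type v} [AddCommGroup M] [Module R M] {ρ σ : RightAct R M}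
    (h : Commuting σ ρ) (r : Rᵐᵒᵖ) : Carries (σ r) ρ ρ :=
  fun s x => h r s x

/-- The right regular action of `R` on itself: `x ⊙ r = x * r`. -/
def regular (R : Type u) [Ring R] : RightAct R R := Module.toModuleEnd R R

variable {M : Type*} [AddCommGroup M] [Module R M]
variable {N : Type*} [AddCommGroup N] [Module R N]
variable {P : Type*} [AddCommGroup P] [Module R P]

/-- The relations `(m ⊙ r) ⊗ n = m ⊗ (r n)`. -/
def Tens.relations (ρ : RightAct R M) (N : Type*) [AddCommGroup N] [Module R N] :
    Submodule R (M ⊗[ℤ] N) :=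
  Submodule.span R {t | ∃ (m : M) (r : R) (n : N), t = (ρ (op r) m) ⊗ₜ[ℤ] n - m ⊗ₜ[ℤ] (r • n)}

/-- The tensor product `M ⊗_R N` over the (noncommutative) ring `R`, formed with the right action
`ρ` on `M` and the left action on `N`; the left action of `R` on `M` makes it a left `R`-module. -/
def Tens (ρ : RightAct R M) (N : Type*) [AddCommGroup N] [Module R N] :=
  (M ⊗[ℤ] N) ⧸ Tens.relations ρ N

namespace Tens

variable (ρ : RightAct R M)

instance : AddCommGroup (Tens ρ N) :=
  inferInstanceAs (AddCommGroup ((M ⊗[ℤ] N) ⧸ Tens.relations ρ N))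

instance : Module R (Tens ρ N) :=
  inferInstanceAs (Module R ((M ⊗[ℤ] N) ⧸ Tens.relations ρ N))

/-- The pure tensor `m ⊗ n`. -/
def tmul (m : M) (n : N) : Tens ρ N := (Tens.relations ρ N).mkQ (m ⊗ₜ[ℤ] n)

lemma add_tmul (m m' : M) (n : N) : tmul ρ (m + m') n = tmul ρ m n + tmul ρ m' n := by
  simp only [tmul, TensorProduct.add_tmul]; exact map_add _ _ _

lemma tmul_add (m : M) (n n' : N) : tmul ρ m (n + n') = tmul ρ m n + tmul ρ m n' := by
  simp only [tmul, TensorProduct.tmul_add]; exact map_add _ _ _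

lemma smul_tmul (r : R) (m : M) (n : N) : tmul ρ (r • m) n = r • tmul ρ m n := by
  simp only [tmul, ← TensorProduct.smul_tmul']; exact map_smul _ _ _

lemma act_tmul (r : R) (m : M) (n : N) : tmul ρ (ρ (op r) m) n = tmul ρ m (r • n) :=
  (Submodule.Quotient.eq _).2 (Submodule.subset_span ⟨m, r, n, rfl⟩)

@[elab_as_elim]
lemma induction {p : Tens ρ N → Prop} (t : Tens ρ N)
    (tmul : ∀ m n, p (tmul ρ m n)) (add : ∀ x y, p x → p y → p (x + y)) : p t := by
  obtain ⟨t, rfl⟩ := Submodule.mkQ_surjective _ t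
  induction t using TensorProduct.induction_on with
  | zero =>
    have h := tmul 0 0
    rwa [Tens.tmul, TensorProduct.zero_tmul] at h
  | tmul m n => exact tmul m n
  | add x y hx hy => rw [map_add]; exact add _ _ hx hy

variable {ρ}

lemma hom_ext {f g : Tens ρ N →ₗ[R] P} (h : ∀ m n, f (tmul ρ m n) = g (tmul ρ m n)) : f = g := by
  ext t
  induction t using Tens.induction with
  | tmul m n => exact h m n
  | add x y hx hy => rw [map_add, map_add, hx, hy]

/-- A biadditive balanced map induces an additive map on the tensor product. -/
def liftAdd {Q : Type*} [AddCommGroup Q] (f : M → N → Q)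
    (add_left : ∀ m m' n, f (m + m') n = f m n + f m' n)
    (add_right : ∀ m n n', f m (n + n') = f m n + f m n')
    (balanced : ∀ (r : R) m n, f (ρ (op r) m) n = f m (r • n)) : Tens ρ N →+ Q :=
  let F : M ⊗[ℤ] N →+ Q := (TensorProduct.lift (R := ℤ)
    (AddMonoidHom.mk' (fun m => (AddMonoidHom.mk' (f m) (add_right m)).toIntLinearMap)
      (fun m m' => by ext n; exact add_left m m' n)).toIntLinearMap).toAddMonoidHom
  QuotientAddGroup.lift (Tens.relations ρ N).toAddSubgroup F (fun x hx => by
    have key : ∀ r : R, F (r • x) = 0 := by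
      refine Submodule.span_induction (p := fun x _ => ∀ r : R, F (r • x) = 0)
        ?_ ?_ ?_ ?_ (show x ∈ Tens.relations ρ N from hx)
      · rintro _ ⟨m, s, n, rfl⟩ r
        rw [smul_sub, map_sub, sub_eq_zero, TensorProduct.smul_tmul', TensorProduct.smul_tmul',
          ← map_smul]
        exact balanced s (r • m) n
      · intro r; rw [smul_zero, map_zero]
      · intro x y _ _ hx hy r; rw [smul_add, map_add, hx, hy, add_zero]
      · intro s x _ hx r; rw [smul_smul]; exact hx _
    simpa using key 1)

@[simp]
lemma liftAdd_tmul {Q : Type*} [AddCommGroup Q] (f : M → N → Q) (h₁ h₂ h₃) (m : M) (n : N) :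
    liftAdd (ρ := ρ) f h₁ h₂ h₃ (tmul ρ m n) = f m n := rfl

/-- The universal property: a biadditive, left linear, balanced map induces a left linear map on
the tensor product. -/
def lift (f : M → N → P) (add_left : ∀ m m' n, f (m + m') n = f m n + f m' n)
    (add_right : ∀ m n n', f m (n + n') = f m n + f m n')
    (smul_left : ∀ (r : R) m n, f (r • m) n = r • f m n)
    (balanced : ∀ (r : R) m n, f (ρ (op r) m) n = f m (r • n)) : Tens ρ N →ₗ[R] P :=
  { liftAdd f add_left add_right balanced with
    map_smul' := fun r t => by
      change liftAdd f add_left add_right balanced (r • t) =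
        r • liftAdd f add_left add_right balanced t
      induction t using Tens.induction with
      | tmul m n => rw [← smul_tmul, liftAdd_tmul, liftAdd_tmul, smul_left]
      | add x y hx hy => rw [smul_add, map_add, map_add, smul_add, hx, hy] }

@[simp]
lemma lift_tmul (f : M → N → P) (h₁ h₂ h₃ h₄) (m : M) (n : N) :
    lift (ρ := ρ) f h₁ h₂ h₃ h₄ (tmul ρ m n) = f m n := rfl

variable {M' : Type*} [AddCommGroup M'] [Module R M'] {ρ' : RightAct R M'}
variable {N' : Type*} [AddCommGroup N'] [Module R N']

/-- The map `f ⊗ g`, for left linear maps `f` and `g` such that `f` respects the right actions over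
which the tensor products are formed. -/
def map (f : M →ₗ[R] M') (hf : Carries f ρ ρ') (g : N →ₗ[R] N') : Tens ρ N →ₗ[R] Tens ρ' N' :=
  lift (fun m n => tmul ρ' (f m) (g n))
    (fun m m' n => by rw [map_add, add_tmul])
    (fun m n n' => by rw [map_add, tmul_add])
    (fun r m n => by rw [map_smul, smul_tmul])
    (fun r m n => by rw [hf, act_tmul, map_smul])

@[simp]
lemma map_tmul (f : M →ₗ[R] M') (hf : Carries f ρ ρ') (g : N →ₗ[R] N') (m : M) (n : N) :
    map f hf g (tmul ρ m n) = tmul ρ' (f m) (g n) := rfl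

lemma carries_id (ρ : RightAct R M) : Carries LinearMap.id ρ ρ := fun _ _ => rfl

/-- The map `f ⊗ 1`. -/
def mapL (f : M →ₗ[R] M') (hf : Carries f ρ ρ') (N : Type*) [AddCommGroup N] [Module R N] :
    Tens ρ N →ₗ[R] Tens ρ' N :=
  map f hf LinearMap.id

/-- The map `1 ⊗ g`. -/
def mapR (ρ : RightAct R M) (g : N →ₗ[R] N') : Tens ρ N →ₗ[R] Tens ρ N' :=
  map LinearMap.id (carries_id ρ) g

@[simp]
lemma mapL_tmul (f : M →ₗ[R] M') (hf : Carries f ρ ρ') (m : M) (n : N) :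
    mapL f hf N (tmul ρ m n) = tmul ρ' (f m) n := rfl

@[simp]
lemma mapR_tmul (g : N →ₗ[R] N') (m : M) (n : N) :
    mapR ρ g (tmul ρ m n) = tmul ρ m (g n) := rfl

lemma zero_tmul (n : N) : tmul ρ (0 : M) n = 0 := by
  have := add_tmul ρ 0 0 n
  rwa [add_zero, left_eq_add] at this

lemma tmul_zero (m : M) : tmul ρ m (0 : N) = 0 := by
  have := tmul_add ρ m (0 : N) 0
  rwa [add_zero, left_eq_add] at this

/-- A right action `σ` on `M` commuting with `ρ` induces one on `M ⊗_R N` formed over `ρ`: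
`(m ⊗ n) ⊙ r = (m ⊙ r) ⊗ n`. -/
def onLeft {ρ σ : RightAct R M} (h : Commuting σ ρ) (N : Type*) [AddCommGroup N] [Module R N] :
    RightAct R (Tens ρ N) where
  toFun r := mapL (σ r) (h.carries r) N
  map_one' := hom_ext fun m n => by simp
  map_mul' r s := hom_ext fun m n => by simp
  map_zero' := hom_ext fun m n => by simp [zero_tmul]
  map_add' r s := hom_ext fun m n => by simp [add_tmul]

/-- A right action `τ` on `N` induces one on `M ⊗_R N`: `(m ⊗ n) ⊙ r = m ⊗ (n ⊙ r)`. -/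
def onRight (ρ : RightAct R M) (τ : RightAct R N) : RightAct R (Tens ρ N) where
  toFun r := mapR ρ (τ r)
  map_one' := hom_ext fun m n => by simp
  map_mul' r s := hom_ext fun m n => by simp
  map_zero' := hom_ext fun m n => by simp [tmul_zero]
  map_add' r s := hom_ext fun m n => by simp [tmul_add]

@[simp]
lemma onLeft_tmul {ρ σ : RightAct R M} (h : Commuting σ ρ) (r : Rᵐᵒᵖ) (m : M) (n : N) :
    onLeft h N r (tmul ρ m n) = tmul ρ (σ r m) n := rfl

@[simp]
lemma onRight_tmul (ρ : RightAct R M) (τ : RightAct R N) (r : Rᵐᵒᵖ) (m : M) (n : N) :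
    onRight ρ τ r (tmul ρ m n) = tmul ρ m (τ r n) := rfl

/-- The map `m ↦ m ⊗ n`. -/
def tmulRight (ρ : RightAct R M) (n : N) : M →ₗ[R] Tens ρ N where
  toFun m := tmul ρ m n
  map_add' m m' := add_tmul ρ m m' n
  map_smul' r m := smul_tmul ρ r m n

@[simp]
lemma tmulRight_apply (m : M) (n : N) : tmulRight ρ n m = tmul ρ m n := rfl

/-- The map `(m ⊗ n) ⊗ p ↦ m ⊗ (n ⊗ p)`; the tensor product with `P` is formed over the right
action `τ` on `N`. -/
def assocHom (ρ : RightAct R M) (τ : RightAct R N) (P : Type*) [AddCommGroup P] [Module R P] :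
    Tens (onRight ρ τ) P →ₗ[R] Tens ρ (Tens τ P) :=
  lift (fun t p => mapR ρ (tmulRight τ p) t)
    (fun t t' p => map_add _ t t')
    (fun t p p' => by
      induction t using Tens.induction with
      | tmul m n => simp [tmul_add]
      | add x y hx hy => simp only [map_add, hx, hy]; abel)
    (fun r t p => map_smul _ r t)
    (fun r t p => by
      induction t using Tens.induction with
      | tmul m n => simp [act_tmul]
      | add x y hx hy => simp only [map_add, hx, hy])

@[simp]
lemma assocHom_tmul (τ : RightAct R N) (m : M) (n : N) (p : P) :
    assocHom ρ τ P (tmul _ (tmul ρ m n) p) = tmul ρ m (tmul τ n p) := rfl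

/-- The map `m ⊗ (n ⊗ p) ↦ (m ⊗ n) ⊗ p`. -/
def assocInv (ρ : RightAct R M) (τ : RightAct R N) (P : Type*) [AddCommGroup P] [Module R P] :
    Tens ρ (Tens τ P) →ₗ[R] Tens (onRight ρ τ) P :=
  lift
    (fun m => liftAdd (fun n p => tmul (onRight ρ τ) (tmul ρ m n) p)
      (fun n n' p => by rw [tmul_add, add_tmul])
      (fun n p p' => by rw [tmul_add])
      (fun r n p => by rw [← act_tmul, onRight_tmul]))
    (fun m m' t => by
      induction t using Tens.induction with
      | tmul n p => simp [add_tmul]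
      | add x y hx hy => simp only [map_add, hx, hy]; abel)
    (fun m t t' => map_add _ t t')
    (fun r m t => by
      induction t using Tens.induction with
      | tmul n p => simp [smul_tmul]
      | add x y hx hy => simp only [map_add, smul_add, hx, hy])
    (fun r m t => by
      induction t using Tens.induction with
      | tmul n p => rw [liftAdd_tmul, ← smul_tmul, liftAdd_tmul, act_tmul]
      | add x y hx hy => simp only [map_add, smul_add, hx, hy])

@[simp]
lemma assocInv_tmul (τ : RightAct R N) (m : M) (n : N) (p : P) :
    assocInv ρ τ P (tmul ρ m (tmul τ n p)) = tmul _ (tmul ρ m n) p := rfl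

/-- The associativity isomorphism `(M ⊗ N) ⊗ P ≃ M ⊗ (N ⊗ P)` of the tensor product over `R`. -/
def assoc (ρ : RightAct R M) (τ : RightAct R N) (P : Type*) [AddCommGroup P] [Module R P] :
    Tens (onRight ρ τ) P ≃ₗ[R] Tens ρ (Tens τ P) :=
  LinearEquiv.ofLinearMap (assocHom ρ τ P) (assocInv ρ τ P)
    (hom_ext fun m t => by
      induction t using Tens.induction with
      | tmul n p => rfl
      | add x y hx hy => rw [tmul_add, map_add, map_add, hx, hy])
    (hom_ext fun t p => by
      induction t using Tens.induction with
      | tmul m n => rfl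
      | add x y hx hy => rw [add_tmul, map_add, map_add, hx, hy])

lemma tmulRight_carries {ρ σ : RightAct R M} (h : Commuting ρ σ) (p : P) :
    Carries (tmulRight σ p) ρ (onLeft h P) := fun _ _ => rfl

/-- The map `T : (m ⊗ n) ⊗ p ↦ (m ⊗ p) ⊗ n`, where `N` and `P` are tensored with `M` over two
commuting right actions `ρ` and `σ`. -/
def swap {ρ σ : RightAct R M} (h : Commuting σ ρ) (h' : Commuting ρ σ)
    (N : Type*) [AddCommGroup N] [Module R N] (P : Type*) [AddCommGroup P] [Module R P] :
    Tens (onLeft h N) P →ₗ[R] Tens (onLeft h' P) N :=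
  lift (fun t p => mapL (tmulRight σ p) (tmulRight_carries h' p) N t)
    (fun t t' p => map_add _ t t')
    (fun t p p' => by
      induction t using Tens.induction with
      | tmul m n => simp [tmul_add, add_tmul]
      | add x y hx hy => simp only [map_add, hx, hy]; abel)
    (fun r t p => map_smul _ r t)
    (fun r t p => by
      induction t using Tens.induction with
      | tmul m n => simp [act_tmul]
      | add x y hx hy => simp only [map_add, hx, hy])

@[simp]
lemma swap_tmul {ρ σ : RightAct R M} (h : Commuting σ ρ) (h' : Commuting ρ σ)
    (m : M) (n : N) (p : P) :
    swap h h' N P (tmul _ (tmul ρ m n) p) = tmul _ (tmul σ m p) n := rfl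

/-- The canonical map `M ⊗ R → M`, `m ⊗ r ↦ m ⊙ r`. -/
def rightUnit (ρ : RightAct R M) : Tens ρ R →ₗ[R] M :=
  lift (fun m r => ρ (op r) m)
    (fun m m' r => map_add _ m m')
    (fun m r r' => by simp)
    (fun s m r => map_smul _ s m)
    (fun s m r => by simp [op_mul])

@[simp]
lemma rightUnit_tmul (m : M) (r : R) : rightUnit ρ (tmul ρ m r) = ρ (op r) m := rfl

end Tens
end Basic

/-! ## 2-fold bimodules and the bifunctor they define -/

/-- A 2-fold bimodule over `R`: a left `R`-module with two right `R`-actions, all three actions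
commuting. -/
structure TwoFoldBimodule (R : Type u) [Ring R] where
  carrier : Type u
  [addCommGroup : AddCommGroup carrier]
  [module : Module R carrier]
  /-- `act₁ (op r) x` is `x ⊙₁ r`. -/
  act₁ : RightAct R carrier
  /-- `act₂ (op r) x` is `x ⊙₂ r`. -/
  act₂ : RightAct R carrier
  comm : Commuting act₁ act₂

namespace TwoFoldBimodule

instance (R : Type u) [Ring R] : CoeSort (TwoFoldBimodule R) (Type u) := ⟨carrier⟩

variable {R : Type u} [Ring R] (Λ : TwoFoldBimodule R)

instance : AddCommGroup Λ := Λ.addCommGroup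
instance : Module R Λ := Λ.module

lemma comm' : Commuting Λ.act₂ Λ.act₁ := fun r s x => (Λ.comm s r x).symm

/-- `Λ ⊗ A` formed over the second right action of `Λ`. -/
abbrev T₂ (A : Type u) [AddCommGroup A] [Module R A] : Type u := Tens Λ.act₂ A

/-- `Λ ⊗ A` formed over the first right action of `Λ`. -/
abbrev T₁ (A : Type u) [AddCommGroup A] [Module R A] : Type u := Tens Λ.act₁ A

/-- The right action on `Λ ⊗ A`, formed over the second right action of `Λ`, that is induced by the
first right action of `Λ`. -/
abbrev T₂act (A : Type u) [AddCommGroup A] [Module R A] : RightAct R (Λ.T₂ A) :=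
  Tens.onLeft Λ.comm A

/-- The right action on `Λ ⊗ A`, formed over the first right action of `Λ`, that is induced by the
second right action of `Λ`. -/
abbrev T₁act (A : Type u) [AddCommGroup A] [Module R A] : RightAct R (Λ.T₁ A) :=
  Tens.onLeft Λ.comm' A

/-- The underlying module of `A ∧ B = Λ_{B,A} ⊗ A ⊗ B`: here `(x ⊙₁ r) ⊗ y ⊗ z = x ⊗ y ⊗ r z` and
`(x ⊙₂ r) ⊗ y ⊗ z = x ⊗ r y ⊗ z`. -/
abbrev Wedge (A B : Type u) [AddCommGroup A] [Module R A] [AddCommGroup B] [Module R B] : Type u :=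
  Tens (Λ.T₂act A) B

/-- The element `x ⊗ y ⊗ z` of `A ∧ B = Λ_{B,A} ⊗ A ⊗ B`. -/
def wtmul {A B : Type u} [AddCommGroup A] [Module R A] [AddCommGroup B] [Module R B]
    (x : Λ) (y : A) (z : B) : Λ.Wedge A B :=
  Tens.tmul _ (Tens.tmul _ x y) z

lemma mapR_carries {A A' : Type u} [AddCommGroup A] [Module R A] [AddCommGroup A'] [Module R A']
    (f : A →ₗ[R] A') : Carries (Tens.mapR Λ.act₂ f) (Λ.T₂act A) (Λ.T₂act A') := by
  intro r t
  induction t using Tens.induction with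
  | tmul m n => rfl
  | add x y hx hy => simp only [map_add, hx, hy]

/-- The map `f ∧ g : x ⊗ y ⊗ z ↦ x ⊗ f y ⊗ g z`. -/
def wedgeMap {A A' B B' : Type u} [AddCommGroup A] [Module R A] [AddCommGroup A'] [Module R A']
    [AddCommGroup B] [Module R B] [AddCommGroup B'] [Module R B']
    (f : A →ₗ[R] A') (g : B →ₗ[R] B') : Λ.Wedge A B →ₗ[R] Λ.Wedge A' B' :=
  Tens.map (Tens.mapR Λ.act₂ f) (Λ.mapR_carries f) g

@[simp]
lemma wedgeMap_wtmul {A A' B B' : Type u} [AddCommGroup A] [Module R A] [AddCommGroup A']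
    [Module R A'] [AddCommGroup B] [Module R B] [AddCommGroup B'] [Module R B']
    (f : A →ₗ[R] A') (g : B →ₗ[R] B') (x : Λ) (y : A) (z : B) :
    Λ.wedgeMap f g (Λ.wtmul x y z) = Λ.wtmul x (f y) (g z) := rfl

lemma wedge_hom_ext {A B P : Type u} [AddCommGroup A] [Module R A] [AddCommGroup B] [Module R B]
    [AddCommGroup P] [Module R P] {f g : Λ.Wedge A B →ₗ[R] P}
    (h : ∀ x y z, f (Λ.wtmul x y z) = g (Λ.wtmul x y z)) : f = g := by
  refine Tens.hom_ext fun t z => ?_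
  induction t using Tens.induction with
  | tmul x y => exact h x y z
  | add x y hx hy => rw [Tens.add_tmul, map_add, map_add, hx, hy]

/-- The bifunctor `A, B ↦ A ∧ B = Λ_{B,A} ⊗ A ⊗ B` on left `R`-modules. -/
def wedge : ModuleCat.{u} R ⥤ ModuleCat.{u} R ⥤ ModuleCat.{u} R where
  obj A :=
    { obj B := ModuleCat.of R (Λ.Wedge A B)
      map g := ModuleCat.ofHom (Λ.wedgeMap LinearMap.id g.hom)
      map_id B := ModuleCat.hom_ext (Λ.wedge_hom_ext fun _ _ _ => rfl)
      map_comp f g := ModuleCat.hom_ext (Λ.wedge_hom_ext fun _ _ _ => rfl) }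
  map f :=
    { app B := ModuleCat.ofHom (Λ.wedgeMap f.hom LinearMap.id)
      naturality B B' g := ModuleCat.hom_ext (Λ.wedge_hom_ext fun _ _ _ => rfl) }
  map_id A := by
    ext B : 2
    exact ModuleCat.hom_ext (Λ.wedge_hom_ext fun _ _ _ => rfl)
  map_comp f g := by
    ext B : 2
    exact ModuleCat.hom_ext (Λ.wedge_hom_ext fun _ _ _ => rfl)

end TwoFoldBimodule

/-! ## Monoidal structures with a prescribed monoidal product -/

section Monoidal

variable {C : Type v} [Category.{u} C]

/-- The map `F f g : F X Y ⟶ F X' Y'` for a bifunctor `F`. -/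
abbrev bimap (F : C ⥤ C ⥤ C) {X X' Y Y' : C} (f : X ⟶ X') (g : Y ⟶ Y') :
    (F.obj X).obj Y ⟶ (F.obj X').obj Y' :=
  (F.map f).app Y ≫ (F.obj X').map g

/-- A monoidal structure on the category `C` whose monoidal product is the bifunctor `F`. -/
structure MonoidalOn (F : C ⥤ C ⥤ C) where
  unit : C
  associator (X Y Z : C) : (F.obj ((F.obj X).obj Y)).obj Z ≅ (F.obj X).obj ((F.obj Y).obj Z)
  leftUnitor (X : C) : (F.obj unit).obj X ≅ X
  rightUnitor (X : C) : (F.obj X).obj unit ≅ X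
  associator_naturality {X X' Y Y' Z Z' : C} (f : X ⟶ X') (g : Y ⟶ Y') (h : Z ⟶ Z') :
    bimap F (bimap F f g) h ≫ (associator X' Y' Z').hom =
      (associator X Y Z).hom ≫ bimap F f (bimap F g h)
  leftUnitor_naturality {X Y : C} (f : X ⟶ Y) :
    (F.obj unit).map f ≫ (leftUnitor Y).hom = (leftUnitor X).hom ≫ f
  rightUnitor_naturality {X Y : C} (f : X ⟶ Y) :
    (F.map f).app unit ≫ (rightUnitor Y).hom = (rightUnitor X).hom ≫ f
  pentagon (W X Y Z : C) :
    (F.map (associator W X Y).hom).app Z ≫ (associator W ((F.obj X).obj Y) Z).hom ≫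
        (F.obj W).map (associator X Y Z).hom =
      (associator ((F.obj W).obj X) Y Z).hom ≫ (associator W X ((F.obj Y).obj Z)).hom
  triangle (X Y : C) :
    (associator X unit Y).hom ≫ (F.obj X).map (leftUnitor Y).hom =
      (F.map (rightUnitor X).hom).app Y

/-- The monoidal category given by a monoidal structure with monoidal product `F`; thus `X ⊗ Y` is
`F X Y`. -/
@[reducible]
def MonoidalOn.toMonoidalCategory {F : C ⥤ C ⥤ C} (S : MonoidalOn F) : MonoidalCategory C where
  tensorObj X Y := (F.obj X).obj Y
  whiskerLeft X _ _ f := (F.obj X).map f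
  whiskerRight f Y := (F.map f).app Y
  tensorHom f g := bimap F f g
  tensorUnit := S.unit
  associator := S.associator
  leftUnitor := S.leftUnitor
  rightUnitor := S.rightUnitor
  tensorHom_def _ _ := rfl
  id_tensorHom_id _ _ := by simp [bimap]
  tensorHom_comp_tensorHom _ _ _ _ := by simp [bimap]
  whiskerLeft_id _ _ := by simp
  id_whiskerRight _ _ := by simp
  associator_naturality := S.associator_naturality
  leftUnitor_naturality := S.leftUnitor_naturality
  rightUnitor_naturality := S.rightUnitor_naturality
  pentagon := S.pentagon
  triangle := S.triangle

/-- An additive closed symmetric monoidal structure on the category `C` whose monoidal product is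
the bifunctor `F`. Closedness is a property: the functors `X ⊗ -` have right adjoints. -/
structure AdditiveClosedSymmetricMonoidalOn [Preadditive C] (F : C ⥤ C ⥤ C) extends
    MonoidalOn F where
  symmetric : @SymmetricCategory C _ toMonoidalOn.toMonoidalCategory
  additive : @MonoidalPreadditive C _ _ toMonoidalOn.toMonoidalCategory
  closed : Nonempty (@MonoidalClosed C _ toMonoidalOn.toMonoidalCategory)

/-- The commutativity isomorphism `F X Y ≅ F Y X`. -/
def AdditiveClosedSymmetricMonoidalOn.braiding [Preadditive C] {F : C ⥤ C ⥤ C}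
    (S : AdditiveClosedSymmetricMonoidalOn F) (X Y : C) :
    (F.obj X).obj Y ≅ (F.obj Y).obj X :=
  letI := S.toMonoidalCategory
  letI := S.symmetric
  BraidedCategory.braiding X Y

end Monoidal

/-! ## The algebraic data -/

section Data

open Tens

variable {R : Type u} [Ring R] (Λ : TwoFoldBimodule R)

/-- An associativity isomorphism, a unit isomorphism and a commutativity isomorphism for the 2-fold
bimodule `Λ`, before any coherence condition is imposed.

`Λ.T₂ Λ` is `Λ_{C,Λ} ⊗ Λ_{B,A}`: `C` is the first right action on the left factor, `B` and `A` are
the first and the second right action on the right factor. `Λ.T₁ Λ` is `Λ_{Λ,A} ⊗ Λ_{C,B}`. -/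
structure StructureMaps where
  a : Λ.T₂ Λ ≃ₗ[R] Λ.T₁ Λ
  a_A : Carries a.toLinearMap (onRight Λ.act₂ Λ.act₂) (Λ.T₁act Λ)
  a_B : Carries a.toLinearMap (onRight Λ.act₂ Λ.act₁) (onRight Λ.act₁ Λ.act₂)
  a_C : Carries a.toLinearMap (Λ.T₂act Λ) (onRight Λ.act₁ Λ.act₁)
  K : ModuleCat.{u} R
  ℓ : Λ.T₂ K ≃ₗ[R] R
  ℓ_B : Carries ℓ.toLinearMap (Λ.T₂act K) (regular R)
  c : Λ ≃ₗ[R] Λ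
  c_B : Carries c.toLinearMap Λ.act₁ Λ.act₂
  c_A : Carries c.toLinearMap Λ.act₂ Λ.act₁

namespace StructureMaps

variable {Λ} (D : StructureMaps Λ)

/-- The pentagon, as an equality of two maps
`Λ_{D,Γ} ⊗ Γ_{C,Δ} ⊗ Δ_{B,A} → Λ_{Γ,A} ⊗ Γ_{Δ,B} ⊗ Δ_{D,C}`, where `Γ = Δ = Λ`. -/
def Pentagon : Prop :=
  -- `a ⊗ 1 : Λ_{D,Γ} ⊗ Γ_{C,Δ} ⊗ Δ_{B,A} → Λ_{Γ,Δ} ⊗ Γ_{D,C} ⊗ Δ_{B,A}`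
  let u₁ : Tens (onRight Λ.act₂ Λ.act₂) Λ →ₗ[R] Tens (Λ.T₁act Λ) Λ :=
    mapL D.a.toLinearMap D.a_A Λ
  -- `1 ⊗ T : Λ_{Γ,Δ} ⊗ Γ_{D,C} ⊗ Δ_{B,A} → Λ_{Δ,Γ} ⊗ Γ_{B,A} ⊗ Δ_{D,C}`
  let u₂ : Tens (Λ.T₁act Λ) Λ →ₗ[R] Tens (Λ.T₂act Λ) Λ :=
    swap Λ.comm' Λ.comm Λ Λ
  -- `a ⊗ 1 : Λ_{Δ,Γ} ⊗ Γ_{B,A} ⊗ Δ_{D,C} → Λ_{Γ,A} ⊗ Γ_{Δ,B} ⊗ Δ_{D,C}`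
  let u₃ : Tens (Λ.T₂act Λ) Λ →ₗ[R] Tens (onRight Λ.act₁ Λ.act₁) Λ :=
    mapL D.a.toLinearMap D.a_C Λ
  -- `1 ⊗ a : Λ_{D,Γ} ⊗ Γ_{C,Δ} ⊗ Δ_{B,A} → Λ_{D,Γ} ⊗ Γ_{Δ,A} ⊗ Δ_{C,B}`
  let v₁ : Tens (onRight Λ.act₂ Λ.act₂) Λ →ₗ[R] Tens (onRight Λ.act₂ Λ.act₁) Λ :=
    (assoc Λ.act₂ Λ.act₁ Λ).symm.toLinearMap ∘ₗ mapR Λ.act₂ D.a.toLinearMap ∘ₗ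
      (assoc Λ.act₂ Λ.act₂ Λ).toLinearMap
  -- `a ⊗ 1 : Λ_{D,Γ} ⊗ Γ_{Δ,A} ⊗ Δ_{C,B} → Λ_{Γ,A} ⊗ Γ_{D,Δ} ⊗ Δ_{C,B}`
  let v₂ : Tens (onRight Λ.act₂ Λ.act₁) Λ →ₗ[R] Tens (onRight Λ.act₁ Λ.act₂) Λ :=
    mapL D.a.toLinearMap D.a_B Λ
  -- `1 ⊗ a : Λ_{Γ,A} ⊗ Γ_{D,Δ} ⊗ Δ_{C,B} → Λ_{Γ,A} ⊗ Γ_{Δ,B} ⊗ Δ_{D,C}`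
  let v₃ : Tens (onRight Λ.act₁ Λ.act₂) Λ →ₗ[R] Tens (onRight Λ.act₁ Λ.act₁) Λ :=
    (assoc Λ.act₁ Λ.act₁ Λ).symm.toLinearMap ∘ₗ mapR Λ.act₁ D.a.toLinearMap ∘ₗ
      (assoc Λ.act₁ Λ.act₂ Λ).toLinearMap
  u₃ ∘ₗ u₂ ∘ₗ u₁ = v₃ ∘ₗ v₂ ∘ₗ v₁

/-- Compatibility of the left and the right unit, as an equality of two maps
`Λ_{B,Λ} ⊗ Λ_{K,A} ⊗ K → Λ_{B,A}`. -/
def UnitCompatibility : Prop :=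
  -- `a ⊗ 1 : Λ_{B,Λ} ⊗ Λ_{K,A} ⊗ K → Λ_{Λ,A} ⊗ Λ_{B,K} ⊗ K`
  let u₁ : Tens (onRight Λ.act₂ Λ.act₁) D.K →ₗ[R] Tens (onRight Λ.act₁ Λ.act₂) D.K :=
    mapL D.a.toLinearMap D.a_B D.K
  -- `1 ⊗ ℓ : Λ_{Λ,A} ⊗ Λ_{B,K} ⊗ K → Λ_{R,A} ⊗ R_B = Λ_{B,A}`
  let u₂ : Tens (onRight Λ.act₁ Λ.act₂) D.K →ₗ[R] Λ :=
    rightUnit Λ.act₁ ∘ₗ mapR Λ.act₁ D.ℓ.toLinearMap ∘ₗ (assoc Λ.act₁ Λ.act₂ D.K).toLinearMap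
  -- `1 ⊗ c ⊗ 1 : Λ_{B,Λ} ⊗ Λ_{K,A} ⊗ K → Λ_{B,Λ} ⊗ Λ_{A,K} ⊗ K`
  let v₁ : Tens (onRight Λ.act₂ Λ.act₁) D.K →ₗ[R] Tens Λ.act₂ (Λ.T₂ D.K) :=
    mapR Λ.act₂ (mapL D.c.toLinearMap D.c_B D.K) ∘ₗ (assoc Λ.act₂ Λ.act₁ D.K).toLinearMap
  -- `1 ⊗ ℓ : Λ_{B,Λ} ⊗ Λ_{A,K} ⊗ K → Λ_{B,R} ⊗ R_A = Λ_{B,A}`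
  let v₂ : Tens Λ.act₂ (Λ.T₂ D.K) →ₗ[R] Λ :=
    rightUnit Λ.act₂ ∘ₗ mapR Λ.act₂ D.ℓ.toLinearMap
  u₂ ∘ₗ u₁ = v₂ ∘ₗ v₁

/-- The hexagon, as an equality of two maps
`Λ_{C,Λ} ⊗ Λ_{B,A} → Λ_{Λ,B} ⊗ Λ_{A,C}`. -/
def Hexagon : Prop :=
  -- `c` on the right factor: `Λ_{C,Λ} ⊗ Λ_{B,A} → Λ_{C,Λ} ⊗ Λ_{A,B}`
  let u₁ : Λ.T₂ Λ →ₗ[R] Λ.T₂ Λ := mapR Λ.act₂ D.c.toLinearMap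
  -- `c` on the right factor: `Λ_{Λ,B} ⊗ Λ_{C,A} → Λ_{Λ,B} ⊗ Λ_{A,C}`
  let u₃ : Λ.T₁ Λ →ₗ[R] Λ.T₁ Λ := mapR Λ.act₁ D.c.toLinearMap
  -- `c` on the left factor: `Λ_{Λ,A} ⊗ Λ_{C,B} → Λ_{A,Λ} ⊗ Λ_{C,B}`
  let v₂ : Λ.T₁ Λ →ₗ[R] Λ.T₂ Λ := mapL D.c.toLinearMap D.c_B Λ
  u₃ ∘ₗ D.a.toLinearMap ∘ₗ u₁ = D.a.toLinearMap ∘ₗ v₂ ∘ₗ D.a.toLinearMap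

end StructureMaps

/-- The data `a`, `K`, `ℓ`, `c` satisfying the coherence conditions. -/
structure CoherentData extends StructureMaps Λ where
  pentagon : toStructureMaps.Pentagon
  unit_compatibility : toStructureMaps.UnitCompatibility
  hexagon : toStructureMaps.Hexagon
  c_c : ∀ x, c (c x) = x

variable {Λ}

/-- For `x ∈ A`, `y ∈ B`, `z ∈ C`, the map `Λ_{C,Λ} ⊗ Λ_{B,A} → (A ∧ B) ∧ C` that sends `p ⊗ q` to
`p ⊗ (q ⊗ x ⊗ y) ⊗ z`. -/
def insertLeft {A B C : Type u} [AddCommGroup A] [Module R A] [AddCommGroup B] [Module R B]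
    [AddCommGroup C] [Module R C] (x : A) (y : B) (z : C) :
    Λ.T₂ Λ →ₗ[R] Λ.Wedge (Λ.Wedge A B) C :=
  tmulRight _ z ∘ₗ mapR Λ.act₂ (tmulRight _ y ∘ₗ tmulRight _ x)

/-- For `x ∈ A`, `y ∈ B`, `z ∈ C`, the map `Λ_{Λ,A} ⊗ Λ_{C,B} → A ∧ (B ∧ C)` that sends `p ⊗ q` to
`p ⊗ x ⊗ (q ⊗ y ⊗ z)`. -/
def insertRight {A B C : Type u} [AddCommGroup A] [Module R A] [AddCommGroup B] [Module R B]
    [AddCommGroup C] [Module R C] (x : A) (y : B) (z : C) :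
    Λ.T₁ Λ →ₗ[R] Λ.Wedge A (Λ.Wedge B C) :=
  map (tmulRight _ x) (tmulRight_carries Λ.comm x) (tmulRight _ z ∘ₗ tmulRight _ y)

@[simp]
lemma insertLeft_tmul {A B C : Type u} [AddCommGroup A] [Module R A] [AddCommGroup B] [Module R B]
    [AddCommGroup C] [Module R C] (x : A) (y : B) (z : C) (p q : Λ) :
    insertLeft x y z (tmul Λ.act₂ p q) = Λ.wtmul p (Λ.wtmul q x y) z := rfl

@[simp]
lemma insertRight_tmul {A B C : Type u} [AddCommGroup A] [Module R A] [AddCommGroup B] [Module R B]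
    [AddCommGroup C] [Module R C] (x : A) (y : B) (z : C) (p q : Λ) :
    insertRight x y z (tmul Λ.act₁ p q) = Λ.wtmul p x (Λ.wtmul q y z) := rfl

/-- The structure `S` on modules and the data `D` belong to each other: up to the usual isomorphisms
for the tensor product, the associativity isomorphism of `S` is `a ⊗ 1 ⊗ 1 ⊗ 1`, the unit of `S` is
`K` with left unit isomorphism `ℓ ⊗ 1`, and the commutativity isomorphism of `S` is `c ⊗ T`, where
`T` interchanges two factors. -/
structure Corresponds (S : AdditiveClosedSymmetricMonoidalOn Λ.wedge) (D : CoherentData Λ) :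
    Prop where
  associator (A B C : ModuleCat.{u} R) (x : A) (y : B) (z : C) (t : Λ.T₂ Λ) :
    (S.associator A B C).hom (insertLeft x y z t) = insertRight x y z (D.a t)
  unit_eq : D.K = S.unit
  leftUnitor (B : ModuleCat.{u} R) (p : Λ) (k : D.K) (y : B) :
    (S.leftUnitor B).hom (Λ.wtmul p (eqToHom unit_eq k) y) = D.ℓ (tmul Λ.act₂ p k) • y
  braiding (A B : ModuleCat.{u} R) (p : Λ) (x : A) (y : B) :
    (S.braiding A B).hom (Λ.wtmul p x y) = Λ.wtmul (D.c p) y x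

end Data

end NFold

end

/-!
A left `R`-module is generated by the images of `1` under the maps `R → A`, `1 ↦ x`. Therefore a
natural map between iterated `∧`-products is determined by its component at the free modules of rank
one, and there the products are iterated tensor products of copies of `Λ`: for instance
`p ↦ p ⊗ 1 ⊗ 1` is an isomorphism `Λ → R ∧ R`, and `insertLeft 1 1 1`, `insertRight 1 1 1` are
isomorphisms onto `(R ∧ R) ∧ R` and `R ∧ (R ∧ R)`.

From a monoidal structure one obtains `a`, `ℓ`, `c` as the components at `R` of the associativity,
left unit and commutativity isomorphisms; these carry the right actions as required because right
multiplications are endomorphisms of the left module `R`, and naturality gives the formulas for all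
modules (`α_insertLeft`, `lu_tmul`, `β_wtmul`). Conversely `a`, `ℓ`, `c` induce maps for all modules
by the universal properties of the triple products (`liftLeft`, `liftRight`), and these maps are
natural. The functor `A ∧ -` is tensoring with the bimodule `Λ ⊗ A`, so it always has the right
adjoint `Hom_R(Λ ⊗ A, -)` (`tensHomEquiv`) and closedness imposes no condition.

Whichever way the two sides have been obtained from one another, each algebraic condition is
equivalent to the corresponding axiom of a symmetric monoidal category: the insertion maps translate
one into the other, they generate the products of arbitrary modules, and they are injective for the
elements `1` of `R` (`StructureMaps.Induces.pentagon_iff`, `triangle_iff`, `hexagon_iff`,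
`symmetry_iff`). The right unit isomorphism is determined by the left one and the commutativity
isomorphism, and the second hexagon identity follows from the first by symmetry. Finally, each of
two corresponding objects determines the other (`Corresponds.data_unique`,
`Corresponds.structure_unique`).
-/

noncomputable section

namespace NFold

/-! ### Bijectivity of maps between tensor products -/

namespace Tens

variable {R : Type u} [Ring R]
variable {M : Type*} [AddCommGroup M] [Module R M]
variable {N : Type*} [AddCommGroup N] [Module R N]
variable {M' : Type*} [AddCommGroup M'] [Module R M']
variable {N' : Type*} [AddCommGroup N'] [Module R N']

lemma tmulRight_one_bijective (ρ : RightAct R M) :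
    Function.Bijective (tmulRight ρ (1 : R)) := by
  constructor
  · refine Function.LeftInverse.injective (g := rightUnit ρ) fun m => ?_
    simp
  · intro t
    induction t using Tens.induction with
    | tmul m r => exact ⟨ρ (op r) m, by simp [act_tmul]⟩
    | add x y hx hy =>
      obtain ⟨m, rfl⟩ := hx
      obtain ⟨n, rfl⟩ := hy
      exact ⟨m + n, map_add _ _ _⟩

lemma map_bijective {ρ : RightAct R M} {ρ' : RightAct R M'} {f : M →ₗ[R] M'}
    (hf : Carries f ρ ρ') {g : N →ₗ[R] N'} (hf' : Function.Bijective f)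
    (hg' : Function.Bijective g) : Function.Bijective (map f hf g) := by
  let e := LinearEquiv.ofBijective f hf'
  let e' := LinearEquiv.ofBijective g hg'
  have he (m : M') : f (e.symm m) = m := e.apply_symm_apply m
  have he' (n : N') : g (e'.symm n) = n := e'.apply_symm_apply n
  have hc : Carries e.symm.toLinearMap ρ' ρ := fun r m => hf'.1 (by
    rw [LinearEquiv.coe_coe, hf, he, he])
  refine Function.bijective_iff_has_inverse.2
    ⟨map e.symm.toLinearMap hc e'.symm.toLinearMap, fun t => ?_, fun t => ?_⟩
  · induction t using Tens.induction with
    | tmul m n =>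
      exact congrArg₂ (tmul ρ) (e.symm_apply_apply m) (e'.symm_apply_apply n)
    | add x y hx hy => rw [map_add, map_add, hx, hy]
  · induction t using Tens.induction with
    | tmul m n => exact congrArg₂ (tmul ρ') (he m) (he' n)
    | add x y hx hy => rw [map_add, map_add, hx, hy]

lemma mapR_bijective (ρ : RightAct R M) {g : N →ₗ[R] N'} (hg : Function.Bijective g) :
    Function.Bijective (mapR ρ g) :=
  map_bijective _ Function.bijective_id hg

end Tens

/-! ### The universal property of `A ∧ B` -/

namespace TwoFoldBimodule

open Tens

variable {R : Type u} [Ring R] {Λ : TwoFoldBimodule R}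
variable {A B C P : Type u} [AddCommGroup A] [Module R A] [AddCommGroup B] [Module R B]
  [AddCommGroup C] [Module R C] [AddCommGroup P] [Module R P]

lemma wtmul_act₁ (r : R) (p : Λ) (x : A) (y : B) :
    Λ.wtmul (Λ.act₁ (op r) p) x y = Λ.wtmul p x (r • y) :=
  act_tmul (Λ.T₂act A) r (tmul Λ.act₂ p x) y

lemma wtmul_act₂ (r : R) (p : Λ) (x : A) (y : B) :
    Λ.wtmul (Λ.act₂ (op r) p) x y = Λ.wtmul p (r • x) y :=
  congrArg (fun t => tmul (Λ.T₂act A) t y) (act_tmul Λ.act₂ r p x)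

lemma smul_wtmul (r : R) (p : Λ) (x : A) (y : B) :
    r • Λ.wtmul p x y = Λ.wtmul (r • p) x y := by
  simp only [wtmul, Tens.smul_tmul]

lemma add_wtmul (p p' : Λ) (x : A) (y : B) :
    Λ.wtmul (p + p') x y = Λ.wtmul p x y + Λ.wtmul p' x y := by
  simp only [wtmul, Tens.add_tmul]

lemma wtmul_add_left (p : Λ) (x x' : A) (y : B) :
    Λ.wtmul p (x + x') y = Λ.wtmul p x y + Λ.wtmul p x' y := by
  simp only [wtmul, Tens.add_tmul, Tens.tmul_add]

lemma wtmul_add_right (p : Λ) (x : A) (y y' : B) :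
    Λ.wtmul p x (y + y') = Λ.wtmul p x y + Λ.wtmul p x y' := by
  simp only [wtmul, Tens.tmul_add]

@[elab_as_elim]
lemma wedge_induction {p : Λ.Wedge A B → Prop} (t : Λ.Wedge A B)
    (wtmul : ∀ q x y, p (Λ.wtmul q x y)) (add : ∀ x y, p x → p y → p (x + y)) : p t := by
  induction t using Tens.induction with
  | tmul s y =>
    induction s using Tens.induction with
    | tmul q x => exact wtmul q x y
    | add s s' hs hs' => rw [Tens.add_tmul]; exact add _ _ hs hs'
  | add x y hx hy => exact add _ _ hx hy

/-- A function `Λ × A × B → Q` that is additive in each variable and balanced over both right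
actions of `Λ`; such functions are the same as additive maps `A ∧ B → Q`. -/
structure IsBalanced {Q : Type*} [AddCommGroup Q] (f : Λ → A → B → Q) : Prop where
  add₁ : ∀ p p' x y, f (p + p') x y = f p x y + f p' x y
  add₂ : ∀ p x x' y, f p (x + x') y = f p x y + f p x' y
  add₃ : ∀ p x y y', f p x (y + y') = f p x y + f p x y'
  act₁ : ∀ (r : R) p x y, f (Λ.act₁ (op r) p) x y = f p x (r • y)
  act₂ : ∀ (r : R) p x y, f (Λ.act₂ (op r) p) x y = f p (r • x) y

/-- The additive map on `A ∧ B` induced by a balanced function. -/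
def wedgeLiftAdd {Q : Type*} [AddCommGroup Q] (f : Λ → A → B → Q) (hf : IsBalanced f) :
    Λ.Wedge A B →+ Q :=
  liftAdd
    (fun t y => liftAdd (ρ := Λ.act₂) (fun p x => f p x y) (fun p p' x => hf.add₁ p p' x y)
      (fun p x x' => hf.add₂ p x x' y) (fun r p x => hf.act₂ r p x y) t)
    (fun t t' y => map_add _ t t')
    (fun t y y' => by
      induction t using Tens.induction with
      | tmul p x => exact hf.add₃ p x y y'
      | add s s' hs hs' => simp only [map_add, hs, hs']; abel)
    (fun r t y => by
      induction t using Tens.induction with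
      | tmul p x => exact hf.act₁ r p x y
      | add s s' hs hs' => simp only [map_add, hs, hs'])

@[simp]
lemma wedgeLiftAdd_wtmul {Q : Type*} [AddCommGroup Q] (f : Λ → A → B → Q) (hf : IsBalanced f)
    (p : Λ) (x : A) (y : B) : wedgeLiftAdd f hf (Λ.wtmul p x y) = f p x y := rfl

/-- The left linear map on `A ∧ B` induced by a balanced function that is left linear in `Λ`. -/
def wedgeLift (f : Λ → A → B → P) (hf : IsBalanced f)
    (hs : ∀ (r : R) p x y, f (r • p) x y = r • f p x y) : Λ.Wedge A B →ₗ[R] P :=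
  { wedgeLiftAdd f hf with
    map_smul' := fun r t => by
      change wedgeLiftAdd f hf (r • t) = r • wedgeLiftAdd f hf t
      induction t using wedge_induction with
      | wtmul p x y => simp only [smul_wtmul, wedgeLiftAdd_wtmul, hs]
      | add s s' hs hs' => simp only [smul_add, map_add, hs, hs'] }

end TwoFoldBimodule

/-! ### The universal properties of `(A ∧ B) ∧ C` and `A ∧ (B ∧ C)` -/

section TripleProducts

open Tens TwoFoldBimodule

variable {R : Type u} [Ring R] {Λ : TwoFoldBimodule R}
variable {A B C P : Type u} [AddCommGroup A] [Module R A] [AddCommGroup B] [Module R B]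
  [AddCommGroup C] [Module R C] [AddCommGroup P] [Module R P]

/-- A family of left linear maps `M → P`, indexed by `A × B × C`, that is additive in each index and
balanced over three right actions `α`, `β`, `γ` on `M`. If these actions commute, such a family
amounts to a left linear map `M ⊗ A ⊗ B ⊗ C → P`. -/
structure BalancedFamily {M : Type*} [AddCommGroup M] [Module R M] (α β γ : RightAct R M)
    (φ : A → B → C → M →ₗ[R] P) : Prop where
  add₁ : ∀ x x' y z t, φ (x + x') y z t = φ x y z t + φ x' y z t
  add₂ : ∀ x y y' z t, φ x (y + y') z t = φ x y z t + φ x y' z t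
  add₃ : ∀ x y z z' t, φ x y (z + z') t = φ x y z t + φ x y z' t
  act₁ : ∀ (r : R) x y z t, φ x y z (α (op r) t) = φ (r • x) y z t
  act₂ : ∀ (r : R) x y z t, φ x y z (β (op r) t) = φ x (r • y) z t
  act₃ : ∀ (r : R) x y z t, φ x y z (γ (op r) t) = φ x y (r • z) t

lemma BalancedFamily.comp {M M' : Type*} [AddCommGroup M] [Module R M] [AddCommGroup M']
    [Module R M'] {α β γ : RightAct R M} {α' β' γ' : RightAct R M'} {φ : A → B → C → M' →ₗ[R] P}
    (hφ : BalancedFamily α' β' γ' φ) {f : M →ₗ[R] M'} (hα : Carries f α α')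
    (hβ : Carries f β β') (hγ : Carries f γ γ') :
    BalancedFamily α β γ (fun x y z => φ x y z ∘ₗ f) where
  add₁ x x' y z t := hφ.add₁ x x' y z (f t)
  add₂ x y y' z t := hφ.add₂ x y y' z (f t)
  add₃ x y z z' t := hφ.add₃ x y z z' (f t)
  act₁ r x y z t := (congrArg (φ x y z) (hα (op r) t)).trans (hφ.act₁ r x y z (f t))
  act₂ r x y z t := (congrArg (φ x y z) (hβ (op r) t)).trans (hφ.act₂ r x y z (f t))
  act₃ r x y z t := (congrArg (φ x y z) (hγ (op r) t)).trans (hφ.act₃ r x y z (f t))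

lemma insertLeft_balanced :
    BalancedFamily (onRight Λ.act₂ Λ.act₂) (onRight Λ.act₂ Λ.act₁) (Λ.T₂act Λ)
      (insertLeft (Λ := Λ) (A := A) (B := B) (C := C)) where
  add₁ x x' y z t := by
    induction t using Tens.induction with
    | tmul p q => simp only [insertLeft_tmul, wtmul_add_left]
    | add s s' hs hs' => simp only [map_add, hs, hs']; abel
  add₂ x y y' z t := by
    induction t using Tens.induction with
    | tmul p q => simp only [insertLeft_tmul, wtmul_add_left, wtmul_add_right]
    | add s s' hs hs' => simp only [map_add, hs, hs']; abel
  add₃ x y z z' t := by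
    induction t using Tens.induction with
    | tmul p q => simp only [insertLeft_tmul, wtmul_add_right]
    | add s s' hs hs' => simp only [map_add, hs, hs']; abel
  act₁ r x y z t := by
    induction t using Tens.induction with
    | tmul p q => simp only [onRight_tmul, insertLeft_tmul, wtmul_act₂]
    | add s s' hs hs' => simp only [map_add, hs, hs']
  act₂ r x y z t := by
    induction t using Tens.induction with
    | tmul p q => simp only [onRight_tmul, insertLeft_tmul, wtmul_act₁]
    | add s s' hs hs' => simp only [map_add, hs, hs']
  act₃ r x y z t := by
    induction t using Tens.induction with
    | tmul p q => simp only [onLeft_tmul, insertLeft_tmul, wtmul_act₁]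
    | add s s' hs hs' => simp only [map_add, hs, hs']

lemma insertRight_balanced :
    BalancedFamily (Λ.T₁act Λ) (onRight Λ.act₁ Λ.act₂) (onRight Λ.act₁ Λ.act₁)
      (insertRight (Λ := Λ) (A := A) (B := B) (C := C)) where
  add₁ x x' y z t := by
    induction t using Tens.induction with
    | tmul p q => simp only [insertRight_tmul, wtmul_add_left]
    | add s s' hs hs' => simp only [map_add, hs, hs']; abel
  add₂ x y y' z t := by
    induction t using Tens.induction with
    | tmul p q => simp only [insertRight_tmul, wtmul_add_left, wtmul_add_right]
    | add s s' hs hs' => simp only [map_add, hs, hs']; abel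
  add₃ x y z z' t := by
    induction t using Tens.induction with
    | tmul p q => simp only [insertRight_tmul, wtmul_add_right]
    | add s s' hs hs' => simp only [map_add, hs, hs']; abel
  act₁ r x y z t := by
    induction t using Tens.induction with
    | tmul p q => simp only [onLeft_tmul, insertRight_tmul, wtmul_act₂]
    | add s s' hs hs' => simp only [map_add, hs, hs']
  act₂ r x y z t := by
    induction t using Tens.induction with
    | tmul p q => simp only [onRight_tmul, insertRight_tmul, wtmul_act₂]
    | add s s' hs hs' => simp only [map_add, hs, hs']
  act₃ r x y z t := by
    induction t using Tens.induction with
    | tmul p q => simp only [onRight_tmul, insertRight_tmul, wtmul_act₁]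
    | add s s' hs hs' => simp only [map_add, hs, hs']

lemma BalancedFamily.isBalanced_left {φ : A → B → C → Λ.T₂ Λ →ₗ[R] P}
    (hφ : BalancedFamily (onRight Λ.act₂ Λ.act₂) (onRight Λ.act₂ Λ.act₁) (Λ.T₂act Λ) φ)
    (p : Λ) (z : C) : IsBalanced fun (q : Λ) x y => φ x y z (tmul Λ.act₂ p q) where
  add₁ q q' x y := by rw [tmul_add, map_add]
  add₂ q x x' y := hφ.add₁ x x' y z _
  add₃ q x y y' := hφ.add₂ x y y' z _
  act₁ r q x y := hφ.act₂ r x y z (tmul Λ.act₂ p q)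
  act₂ r q x y := hφ.act₁ r x y z (tmul Λ.act₂ p q)

lemma BalancedFamily.isBalanced_right {φ : A → B → C → Λ.T₁ Λ →ₗ[R] P}
    (hφ : BalancedFamily (Λ.T₁act Λ) (onRight Λ.act₁ Λ.act₂) (onRight Λ.act₁ Λ.act₁) φ)
    (p : Λ) (x : A) : IsBalanced fun (q : Λ) y z => φ x y z (tmul Λ.act₁ p q) where
  add₁ q q' y z := by rw [tmul_add, map_add]
  add₂ q y y' z := hφ.add₂ x y y' z _
  add₃ q y z z' := hφ.add₃ x y z z' _
  act₁ r q y z := hφ.act₃ r x y z (tmul Λ.act₁ p q)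
  act₂ r q y z := hφ.act₂ r x y z (tmul Λ.act₁ p q)

/-- The left linear map `(A ∧ B) ∧ C → P` induced by a balanced family of maps
`Λ_{C,Λ} ⊗ Λ_{B,A} → P`. -/
def liftLeft (φ : A → B → C → Λ.T₂ Λ →ₗ[R] P)
    (hφ : BalancedFamily (onRight Λ.act₂ Λ.act₂) (onRight Λ.act₂ Λ.act₁) (Λ.T₂act Λ) φ) :
    Λ.Wedge (Λ.Wedge A B) C →ₗ[R] P :=
  wedgeLift (fun p t z => wedgeLiftAdd _ (hφ.isBalanced_left p z) t)
    { add₁ := fun p p' t z => by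
        induction t using wedge_induction with
        | wtmul q x y => simp only [wedgeLiftAdd_wtmul, add_tmul, map_add]
        | add s s' hs hs' => simp only [map_add, hs, hs']; abel
      add₂ := fun p t t' z => map_add _ t t'
      add₃ := fun p t z z' => by
        induction t using wedge_induction with
        | wtmul q x y => exact hφ.add₃ x y z z' _
        | add s s' hs hs' => simp only [map_add, hs, hs']; abel
      act₁ := fun r p t z => by
        induction t using wedge_induction with
        | wtmul q x y => exact hφ.act₃ r x y z (tmul Λ.act₂ p q)
        | add s s' hs hs' => simp only [map_add, hs, hs']
      act₂ := fun r p t z => by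
        induction t using wedge_induction with
        | wtmul q x y => simp only [smul_wtmul, wedgeLiftAdd_wtmul, act_tmul]
        | add s s' hs hs' => simp only [smul_add, map_add, hs, hs'] }
    (fun r p t z => by
      induction t using wedge_induction with
      | wtmul q x y => simp only [wedgeLiftAdd_wtmul, smul_tmul, map_smul]
      | add s s' hs hs' => simp only [smul_add, map_add, hs, hs'])

@[simp]
lemma liftLeft_insertLeft (φ : A → B → C → Λ.T₂ Λ →ₗ[R] P)
    (hφ : BalancedFamily (onRight Λ.act₂ Λ.act₂) (onRight Λ.act₂ Λ.act₁) (Λ.T₂act Λ) φ)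
    (x : A) (y : B) (z : C) (t : Λ.T₂ Λ) : liftLeft φ hφ (insertLeft x y z t) = φ x y z t := by
  induction t using Tens.induction with
  | tmul p q => rfl
  | add s s' hs hs' => simp only [map_add, hs, hs']

/-- The left linear map `A ∧ (B ∧ C) → P` induced by a balanced family of maps
`Λ_{Λ,A} ⊗ Λ_{C,B} → P`. -/
def liftRight (φ : A → B → C → Λ.T₁ Λ →ₗ[R] P)
    (hφ : BalancedFamily (Λ.T₁act Λ) (onRight Λ.act₁ Λ.act₂) (onRight Λ.act₁ Λ.act₁) φ) :
    Λ.Wedge A (Λ.Wedge B C) →ₗ[R] P :=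
  wedgeLift (fun p x t => wedgeLiftAdd _ (hφ.isBalanced_right p x) t)
    { add₁ := fun p p' x t => by
        induction t using wedge_induction with
        | wtmul q y z => simp only [wedgeLiftAdd_wtmul, add_tmul, map_add]
        | add s s' hs hs' => simp only [map_add, hs, hs']; abel
      add₂ := fun p x x' t => by
        induction t using wedge_induction with
        | wtmul q y z => exact hφ.add₁ x x' y z _
        | add s s' hs hs' => simp only [map_add, hs, hs']; abel
      add₃ := fun p x t t' => map_add _ t t'
      act₁ := fun r p x t => by
        induction t using wedge_induction with
        | wtmul q y z => simp only [smul_wtmul, wedgeLiftAdd_wtmul, act_tmul]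
        | add s s' hs hs' => simp only [smul_add, map_add, hs, hs']
      act₂ := fun r p x t => by
        induction t using wedge_induction with
        | wtmul q y z => exact hφ.act₁ r x y z (tmul Λ.act₁ p q)
        | add s s' hs hs' => simp only [map_add, hs, hs'] }
    (fun r p x t => by
      induction t using wedge_induction with
      | wtmul q y z => simp only [wedgeLiftAdd_wtmul, smul_tmul, map_smul]
      | add s s' hs hs' => simp only [smul_add, map_add, hs, hs'])

@[simp]
lemma liftRight_insertRight (φ : A → B → C → Λ.T₁ Λ →ₗ[R] P)
    (hφ : BalancedFamily (Λ.T₁act Λ) (onRight Λ.act₁ Λ.act₂) (onRight Λ.act₁ Λ.act₁) φ)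
    (x : A) (y : B) (z : C) (t : Λ.T₁ Λ) : liftRight φ hφ (insertRight x y z t) = φ x y z t := by
  induction t using Tens.induction with
  | tmul p q => rfl
  | add s s' hs hs' => simp only [map_add, hs, hs']

/-- The images of the maps `insertLeft x y z` generate `(A ∧ B) ∧ C`. -/
lemma hom_ext_insertLeft {f g : Λ.Wedge (Λ.Wedge A B) C →ₗ[R] P}
    (h : ∀ x y z t, f (insertLeft x y z t) = g (insertLeft x y z t)) : f = g := by
  refine Λ.wedge_hom_ext fun p t z => ?_
  induction t using wedge_induction with
  | wtmul q x y => exact h x y z (tmul Λ.act₂ p q)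
  | add s s' hs hs' => simp only [wtmul_add_left, map_add, hs, hs']

/-- The images of the maps `insertRight x y z` generate `A ∧ (B ∧ C)`. -/
lemma hom_ext_insertRight {f g : Λ.Wedge A (Λ.Wedge B C) →ₗ[R] P}
    (h : ∀ x y z t, f (insertRight x y z t) = g (insertRight x y z t)) : f = g := by
  refine Λ.wedge_hom_ext fun p x t => ?_
  induction t using wedge_induction with
  | wtmul q y z => exact h x y z (tmul Λ.act₁ p q)
  | add s s' hs hs' => simp only [wtmul_add_right, map_add, hs, hs']

variable {A' B' C' : Type u} [AddCommGroup A'] [Module R A'] [AddCommGroup B'] [Module R B']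
  [AddCommGroup C'] [Module R C']

lemma wedgeMap_insertLeft (f : A →ₗ[R] A') (g : B →ₗ[R] B') (h : C →ₗ[R] C') (x : A) (y : B)
    (z : C) (t : Λ.T₂ Λ) :
    Λ.wedgeMap (Λ.wedgeMap f g) h (insertLeft x y z t) = insertLeft (f x) (g y) (h z) t := by
  induction t using Tens.induction with
  | tmul p q => rfl
  | add s s' hs hs' => simp only [map_add, hs, hs']

lemma wedgeMap_insertRight (f : A →ₗ[R] A') (g : B →ₗ[R] B') (h : C →ₗ[R] C') (x : A) (y : B)
    (z : C) (t : Λ.T₁ Λ) :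
    Λ.wedgeMap f (Λ.wedgeMap g h) (insertRight x y z t) = insertRight (f x) (g y) (h z) t := by
  induction t using Tens.induction with
  | tmul p q => rfl
  | add s s' hs hs' => simp only [map_add, hs, hs']

/-! ### Evaluation at the free module of rank one -/

variable (Λ)

lemma tmulRight_tmulRight_one_bijective :
    Function.Bijective (tmulRight (Λ.T₂act R) (1 : R) ∘ₗ tmulRight Λ.act₂ (1 : R)) :=
  (tmulRight_one_bijective _).comp (tmulRight_one_bijective _)

lemma insertLeft_one_bijective :
    Function.Bijective (insertLeft (Λ := Λ) (1 : R) (1 : R) (1 : R)) :=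
  (tmulRight_one_bijective _).comp (mapR_bijective _ (tmulRight_tmulRight_one_bijective Λ))

lemma insertRight_one_bijective :
    Function.Bijective (insertRight (Λ := Λ) (1 : R) (1 : R) (1 : R)) :=
  map_bijective _ (tmulRight_one_bijective _) (tmulRight_tmulRight_one_bijective Λ)

end TripleProducts

/-! ### Products of four modules -/

section FourfoldProducts

open Tens TwoFoldBimodule

variable {R : Type u} [Ring R] {Λ : TwoFoldBimodule R}
variable {W X Y Z P : Type u} [AddCommGroup W] [Module R W] [AddCommGroup X] [Module R X]
  [AddCommGroup Y] [Module R Y] [AddCommGroup Z] [Module R Z] [AddCommGroup P] [Module R P]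

/-- The map `Λ_{D,Γ} ⊗ Γ_{C,Δ} ⊗ Δ_{B,A} → ((W ∧ X) ∧ Y) ∧ Z` that sends `p ⊗ q ⊗ r` to
`p ⊗ (q ⊗ (r ⊗ w ⊗ x) ⊗ y) ⊗ z`. -/
def insertLeftLeft (w : W) (x : X) (y : Y) (z : Z) :
    Tens (onRight Λ.act₂ Λ.act₂) Λ →ₗ[R] Λ.Wedge (Λ.Wedge (Λ.Wedge W X) Y) Z :=
  tmulRight _ z ∘ₗ mapR Λ.act₂ (insertLeft w x y) ∘ₗ (assoc Λ.act₂ Λ.act₂ Λ).toLinearMap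

/-- The map `Λ_{D,Γ} ⊗ Γ_{Δ,A} ⊗ Δ_{C,B} → (W ∧ (X ∧ Y)) ∧ Z` that sends `p ⊗ q ⊗ r` to
`p ⊗ (q ⊗ w ⊗ (r ⊗ x ⊗ y)) ⊗ z`. -/
def insertLeftRight (w : W) (x : X) (y : Y) (z : Z) :
    Tens (onRight Λ.act₂ Λ.act₁) Λ →ₗ[R] Λ.Wedge (Λ.Wedge W (Λ.Wedge X Y)) Z :=
  tmulRight _ z ∘ₗ mapR Λ.act₂ (insertRight w x y) ∘ₗ (assoc Λ.act₂ Λ.act₁ Λ).toLinearMap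

/-- The map `Λ_{Γ,A} ⊗ Γ_{D,Δ} ⊗ Δ_{C,B} → W ∧ ((X ∧ Y) ∧ Z)` that sends `p ⊗ q ⊗ r` to
`p ⊗ w ⊗ (q ⊗ (r ⊗ x ⊗ y) ⊗ z)`. -/
def insertRightLeft (w : W) (x : X) (y : Y) (z : Z) :
    Tens (onRight Λ.act₁ Λ.act₂) Λ →ₗ[R] Λ.Wedge W (Λ.Wedge (Λ.Wedge X Y) Z) :=
  map (tmulRight _ w) (tmulRight_carries Λ.comm w) (insertLeft x y z) ∘ₗ
    (assoc Λ.act₁ Λ.act₂ Λ).toLinearMap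

/-- The map `Λ_{Γ,A} ⊗ Γ_{Δ,B} ⊗ Δ_{D,C} → W ∧ (X ∧ (Y ∧ Z))` that sends `p ⊗ q ⊗ r` to
`p ⊗ w ⊗ (q ⊗ x ⊗ (r ⊗ y ⊗ z))`. -/
def insertRightRight (w : W) (x : X) (y : Y) (z : Z) :
    Tens (onRight Λ.act₁ Λ.act₁) Λ →ₗ[R] Λ.Wedge W (Λ.Wedge X (Λ.Wedge Y Z)) :=
  map (tmulRight _ w) (tmulRight_carries Λ.comm w) (insertRight x y z) ∘ₗ
    (assoc Λ.act₁ Λ.act₁ Λ).toLinearMap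

lemma insertLeftLeft_tmul (w : W) (x : X) (y : Y) (z : Z) (s : Λ.T₂ Λ) (r : Λ) :
    insertLeftLeft w x y z (tmul _ s r) = insertLeft (Λ.wtmul r w x) y z s := by
  induction s using Tens.induction with
  | tmul p q => rfl
  | add s s' hs hs' => simp only [add_tmul, map_add, hs, hs']

lemma insertLeftRight_tmul (w : W) (x : X) (y : Y) (z : Z) (s : Λ.T₂ Λ) (r : Λ) :
    insertLeftRight w x y z (tmul _ s r) = insertLeft w (Λ.wtmul r x y) z s := by
  induction s using Tens.induction with
  | tmul p q => rfl
  | add s s' hs hs' => simp only [add_tmul, map_add, hs, hs']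

lemma insertRightLeft_tmul (w : W) (x : X) (y : Y) (z : Z) (s : Λ.T₁ Λ) (r : Λ) :
    insertRightLeft w x y z (tmul _ s r) = insertRight w (Λ.wtmul r x y) z s := by
  induction s using Tens.induction with
  | tmul p q => rfl
  | add s s' hs hs' => simp only [add_tmul, map_add, hs, hs']

lemma insertRightRight_tmul (w : W) (x : X) (y : Y) (z : Z) (s : Λ.T₁ Λ) (r : Λ) :
    insertRightRight w x y z (tmul _ s r) = insertRight w x (Λ.wtmul r y z) s := by
  induction s using Tens.induction with
  | tmul p q => rfl
  | add s s' hs hs' => simp only [add_tmul, map_add, hs, hs']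

/-- The images of the maps `insertLeftLeft w x y z` generate `((W ∧ X) ∧ Y) ∧ Z`. -/
lemma hom_ext_insertLeftLeft {f g : Λ.Wedge (Λ.Wedge (Λ.Wedge W X) Y) Z →ₗ[R] P}
    (h : ∀ w x y z t, f (insertLeftLeft w x y z t) = g (insertLeftLeft w x y z t)) : f = g := by
  refine hom_ext_insertLeft fun s y z t => ?_
  induction s using wedge_induction with
  | wtmul r w x => simpa only [insertLeftLeft_tmul] using h w x y z (tmul _ t r)
  | add s s' hs hs' => simp only [insertLeft_balanced.add₁, map_add, hs, hs']

lemma insertRightRight_one_injective :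
    Function.Injective (insertRightRight (Λ := Λ) (1 : R) (1 : R) (1 : R) (1 : R)) :=
  ((map_bijective (tmulRight_carries Λ.comm (1 : R)) (tmulRight_one_bijective _)
    (insertRight_one_bijective Λ)).comp (assoc Λ.act₁ Λ.act₁ Λ).bijective).1

lemma wedgeMap_insertLeftLeft (f : Λ.Wedge (Λ.Wedge W X) Y →ₗ[R] P) (w : W) (x : X) (y : Y)
    (z : Z) (p : Λ) (t : Λ.T₂ Λ) :
    Λ.wedgeMap f LinearMap.id (insertLeftLeft w x y z ((assoc _ _ _).symm (tmul Λ.act₂ p t))) =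
      Λ.wtmul p (f (insertLeft w x y t)) z := by
  induction t using Tens.induction with
  | tmul q r => rfl
  | add s s' hs hs' => simp only [tmul_add, map_add, hs, hs', wtmul_add_left]

lemma insertLeftRight_assoc_symm (w : W) (x : X) (y : Y) (z : Z) (p : Λ) (t : Λ.T₁ Λ) :
    insertLeftRight w x y z ((assoc _ _ _).symm (tmul Λ.act₂ p t)) =
      Λ.wtmul p (insertRight w x y t) z := by
  induction t using Tens.induction with
  | tmul q r => rfl
  | add s s' hs hs' => simp only [tmul_add, map_add, hs, hs', wtmul_add_left]

lemma wedgeMap_insertRightLeft (f : Λ.Wedge (Λ.Wedge X Y) Z →ₗ[R] P) (w : W) (x : X) (y : Y)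
    (z : Z) (p : Λ) (t : Λ.T₂ Λ) :
    Λ.wedgeMap LinearMap.id f (insertRightLeft w x y z ((assoc _ _ _).symm (tmul Λ.act₁ p t))) =
      Λ.wtmul p w (f (insertLeft x y z t)) := by
  induction t using Tens.induction with
  | tmul q r => rfl
  | add s s' hs hs' => simp only [tmul_add, map_add, hs, hs', wtmul_add_right]

lemma insertRightRight_assoc_symm (w : W) (x : X) (y : Y) (z : Z) (p : Λ) (t : Λ.T₁ Λ) :
    insertRightRight w x y z ((assoc _ _ _).symm (tmul Λ.act₁ p t)) =
      Λ.wtmul p w (insertRight x y z t) := by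
  induction t using Tens.induction with
  | tmul q r => rfl
  | add s s' hs hs' => simp only [tmul_add, map_add, hs, hs', wtmul_add_right]

end FourfoldProducts

/-! ### Coherence of induced families of maps -/

section Coherence

open Tens TwoFoldBimodule

variable {R : Type u} [Ring R] {Λ : TwoFoldBimodule R}

/-- The families `α`, `lu`, `ru`, `β` of linear maps are the associativity, left unit, right unit
and commutativity maps given by the data `D`. The right unit map is the composite of the
commutativity map and the left unit map. -/
structure StructureMaps.Induces (D : StructureMaps Λ)
    (α : ∀ A B C : ModuleCat.{u} R, Λ.Wedge (Λ.Wedge A B) C →ₗ[R] Λ.Wedge A (Λ.Wedge B C))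
    (lu : ∀ A : ModuleCat.{u} R, Λ.Wedge D.K A →ₗ[R] A)
    (ru : ∀ A : ModuleCat.{u} R, Λ.Wedge A D.K →ₗ[R] A)
    (β : ∀ A B : ModuleCat.{u} R, Λ.Wedge A B →ₗ[R] Λ.Wedge B A) : Prop where
  associator : ∀ A B C x y z t, α A B C (insertLeft x y z t) = insertRight x y z (D.a t)
  leftUnitor : ∀ A p k x, lu A (Λ.wtmul p k x) = D.ℓ (tmul Λ.act₂ p k) • x
  rightUnitor : ∀ A p x k, ru A (Λ.wtmul p x k) = D.ℓ (tmul Λ.act₂ (D.c p) k) • x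
  braiding : ∀ A B p x y, β A B (Λ.wtmul p x y) = Λ.wtmul (D.c p) y x

namespace StructureMaps.Induces

variable {D : StructureMaps Λ}
  {α : ∀ A B C : ModuleCat.{u} R, Λ.Wedge (Λ.Wedge A B) C →ₗ[R] Λ.Wedge A (Λ.Wedge B C)}
  {lu : ∀ A : ModuleCat.{u} R, Λ.Wedge D.K A →ₗ[R] A}
  {ru : ∀ A : ModuleCat.{u} R, Λ.Wedge A D.K →ₗ[R] A}
  {β : ∀ A B : ModuleCat.{u} R, Λ.Wedge A B →ₗ[R] Λ.Wedge B A}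

/-- The insertion maps carry the two composites of the algebraic pentagon to the two composites of
the monoidal one. They generate the source, and for the elements `1` of `R` they are injective into
the target. -/
lemma pentagon_iff (h : D.Induces α lu ru β) :
    D.Pentagon ↔ ∀ W X Y Z : ModuleCat.{u} R,
      α W X (ModuleCat.of R (Λ.Wedge Y Z)) ∘ₗ α (ModuleCat.of R (Λ.Wedge W X)) Y Z =
        Λ.wedgeMap LinearMap.id (α X Y Z) ∘ₗ α W (ModuleCat.of R (Λ.Wedge X Y)) Z ∘ₗ
          Λ.wedgeMap (α W X Y) LinearMap.id := by
  -- Both sides of the pentagon for `W, X, Y, Z`, evaluated at an element of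
  -- `Λ_{D,Γ} ⊗ Γ_{C,Δ} ⊗ Δ_{B,A}` inserted along `w, x, y, z`.
  have left (W X Y Z : ModuleCat.{u} R) (w : W) (x : X) (y : Y) (z : Z)
      (t : Tens (onRight Λ.act₂ Λ.act₂) Λ) :
      α W X (ModuleCat.of R (Λ.Wedge Y Z)) (α (ModuleCat.of R (Λ.Wedge W X)) Y Z
        (insertLeftLeft w x y z t)) =
      insertRightRight w x y z (mapL D.a.toLinearMap D.a_C Λ (swap Λ.comm' Λ.comm Λ Λ
        (mapL D.a.toLinearMap D.a_A Λ t))) := by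
    have step (r : Λ) (s : Λ.T₁ Λ) :
        α W X (ModuleCat.of R (Λ.Wedge Y Z)) (insertRight (Λ.wtmul r w x) y z s) =
          insertRightRight w x y z (mapL D.a.toLinearMap D.a_C Λ (swap Λ.comm' Λ.comm Λ Λ
            (tmul (Λ.T₁act Λ) s r))) := by
      induction s using Tens.induction with
      | tmul p q =>
        rw [swap_tmul, mapL_tmul, insertRightRight_tmul]
        exact h.associator W X (ModuleCat.of R (Λ.Wedge Y Z)) w x (Λ.wtmul q y z) (tmul _ p r)
      | add s s' hs hs' => simp only [add_tmul, map_add, hs, hs']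
    induction t using Tens.induction with
    | tmul s r =>
      rw [insertLeftLeft_tmul, mapL_tmul, ← step]
      exact congrArg _ (h.associator (ModuleCat.of R (Λ.Wedge W X)) Y Z (Λ.wtmul r w x) y z s)
    | add s s' hs hs' => simp only [map_add, hs, hs']
  have right (W X Y Z : ModuleCat.{u} R) (w : W) (x : X) (y : Y) (z : Z)
      (t : Tens (onRight Λ.act₂ Λ.act₂) Λ) :
      Λ.wedgeMap LinearMap.id (α X Y Z) (α W (ModuleCat.of R (Λ.Wedge X Y)) Z
        (Λ.wedgeMap (α W X Y) LinearMap.id (insertLeftLeft w x y z t))) =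
      insertRightRight w x y z ((assoc Λ.act₁ Λ.act₁ Λ).symm (mapR Λ.act₁ D.a.toLinearMap
        (assoc Λ.act₁ Λ.act₂ Λ (mapL D.a.toLinearMap D.a_B Λ ((assoc Λ.act₂ Λ.act₁ Λ).symm
          (mapR Λ.act₂ D.a.toLinearMap (assoc Λ.act₂ Λ.act₂ Λ t))))))) := by
    have step₁ (s : Tens Λ.act₂ (Λ.T₂ Λ)) :
        Λ.wedgeMap (α W X Y) LinearMap.id (insertLeftLeft w x y z ((assoc _ _ _).symm s)) =
          insertLeftRight w x y z ((assoc Λ.act₂ Λ.act₁ Λ).symm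
            (mapR Λ.act₂ D.a.toLinearMap s)) := by
      induction s using Tens.induction with
      | tmul p t =>
        rw [wedgeMap_insertLeftLeft, mapR_tmul, insertLeftRight_assoc_symm, h.associator]
        rfl
      | add s s' hs hs' => simp only [map_add, hs, hs']
    have step₂ (s : Tens (onRight Λ.act₂ Λ.act₁) Λ) :
        α W (ModuleCat.of R (Λ.Wedge X Y)) Z (insertLeftRight w x y z s) =
          insertRightLeft w x y z (mapL D.a.toLinearMap D.a_B Λ s) := by
      induction s using Tens.induction with
      | tmul t r =>
        rw [insertLeftRight_tmul, mapL_tmul, insertRightLeft_tmul]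
        exact h.associator W (ModuleCat.of R (Λ.Wedge X Y)) Z w (Λ.wtmul r x y) z t
      | add s s' hs hs' => simp only [map_add, hs, hs']
    have step₃ (s : Tens Λ.act₁ (Λ.T₂ Λ)) :
        Λ.wedgeMap LinearMap.id (α X Y Z) (insertRightLeft w x y z ((assoc _ _ _).symm s)) =
          insertRightRight w x y z ((assoc Λ.act₁ Λ.act₁ Λ).symm
            (mapR Λ.act₁ D.a.toLinearMap s)) := by
      induction s using Tens.induction with
      | tmul p t =>
        rw [wedgeMap_insertRightLeft, mapR_tmul, insertRightRight_assoc_symm, h.associator]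
        rfl
      | add s s' hs hs' => simp only [map_add, hs, hs']
    have h₁ := step₁ (assoc Λ.act₂ Λ.act₂ Λ t)
    rw [LinearEquiv.symm_apply_apply] at h₁
    have h₃ := step₃ (assoc Λ.act₁ Λ.act₂ Λ (mapL D.a.toLinearMap D.a_B Λ
      ((assoc Λ.act₂ Λ.act₁ Λ).symm (mapR Λ.act₂ D.a.toLinearMap (assoc Λ.act₂ Λ.act₂ Λ t)))))
    rw [LinearEquiv.symm_apply_apply] at h₃
    rw [h₁, ← h₃]
    exact congrArg _ (step₂ _)
  constructor
  · intro hp W X Y Z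
    refine hom_ext_insertLeftLeft fun w x y z t => ?_
    exact (left W X Y Z w x y z t).trans
      ((congrArg (insertRightRight w x y z) (LinearMap.congr_fun hp t)).trans
        (right W X Y Z w x y z t).symm)
  · intro hα
    refine LinearMap.ext fun t => insertRightRight_one_injective ?_
    let F := ModuleCat.of R R
    exact (left F F F F (1 : R) (1 : R) (1 : R) (1 : R) t).symm.trans
      ((LinearMap.congr_fun (hα F F F F) _).trans (right F F F F (1 : R) (1 : R) (1 : R) (1 : R) t))

/-- The triangle axiom evaluated at `p ⊗ (q ⊗ x ⊗ k) ⊗ y`: both sides are of the form `s ⊗ x ⊗ y`,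
and the two elements `s` of `Λ` are the values of the two composites in the compatibility of left
and right unit. -/
lemma triangle_iff (h : D.Induces α lu ru β) :
    D.UnitCompatibility ↔ ∀ X Y : ModuleCat.{u} R,
      Λ.wedgeMap LinearMap.id (lu Y) ∘ₗ α X D.K Y = Λ.wedgeMap (ru X) LinearMap.id := by
  have left (X Y : ModuleCat.{u} R) (x : X) (k : D.K) (y : Y) (t : Λ.T₂ Λ) :
      Λ.wedgeMap LinearMap.id (lu Y) (α X D.K Y (insertLeft x k y t)) =
        Λ.wtmul (rightUnit Λ.act₁ (mapR Λ.act₁ D.ℓ.toLinearMap (assoc Λ.act₁ Λ.act₂ D.K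
          (mapL D.a.toLinearMap D.a_B D.K (tmul _ t k))))) x y := by
    rw [h.associator, mapL_tmul]
    generalize D.a t = s
    change _ = Λ.wtmul (rightUnit Λ.act₁ (mapR Λ.act₁ D.ℓ.toLinearMap (assoc Λ.act₁ Λ.act₂ D.K
          (tmul _ s k)))) x y
    induction s using Tens.induction with
    | tmul p q =>
      change Λ.wtmul p x (lu Y (Λ.wtmul q k y)) =
        Λ.wtmul (Λ.act₁ (op (D.ℓ (tmul Λ.act₂ q k))) p) x y
      rw [h.leftUnitor, wtmul_act₁]
    | add s s' hs hs' => simp only [add_tmul, map_add, add_wtmul, hs, hs']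
  have right (X Y : ModuleCat.{u} R) (x : X) (k : D.K) (y : Y) (t : Λ.T₂ Λ) :
      Λ.wedgeMap (ru X) LinearMap.id (insertLeft x k y t) =
        Λ.wtmul (rightUnit Λ.act₂ (mapR Λ.act₂ D.ℓ.toLinearMap
          (mapR Λ.act₂ (mapL D.c.toLinearMap D.c_B D.K)
            (assoc Λ.act₂ Λ.act₁ D.K (tmul _ t k))))) x y := by
    induction t using Tens.induction with
    | tmul p q =>
      change Λ.wtmul p (ru X (Λ.wtmul q x k)) y =
        Λ.wtmul (Λ.act₂ (op (D.ℓ (tmul Λ.act₂ (D.c q) k))) p) x y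
      rw [h.rightUnitor, wtmul_act₂]
    | add s s' hs hs' => simp only [add_tmul, map_add, add_wtmul, hs, hs']
  constructor
  · intro hu X Y
    refine hom_ext_insertLeft fun x k y t => ?_
    exact (left X Y x k y t).trans ((congrArg (fun q => Λ.wtmul q x y)
      (LinearMap.congr_fun hu (tmul _ t k))).trans (right X Y x k y t).symm)
  · intro hα
    let F := ModuleCat.of R R
    refine Tens.hom_ext fun t k => (tmulRight_tmulRight_one_bijective Λ).1 ?_
    exact (left F F (1 : R) k (1 : R) t).symm.trans
      ((LinearMap.congr_fun (hα F F) _).trans (right F F (1 : R) k (1 : R) t))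

lemma hexagon_iff (h : D.Induces α lu ru β) :
    D.Hexagon ↔ ∀ X Y Z : ModuleCat.{u} R,
      α Y Z X ∘ₗ β X (ModuleCat.of R (Λ.Wedge Y Z)) ∘ₗ α X Y Z =
        Λ.wedgeMap LinearMap.id (β X Z) ∘ₗ α Y X Z ∘ₗ Λ.wedgeMap (β X Y) LinearMap.id := by
  have left (X Y Z : ModuleCat.{u} R) (x : X) (y : Y) (z : Z) (t : Λ.T₂ Λ) :
      α Y Z X (β X (ModuleCat.of R (Λ.Wedge Y Z)) (α X Y Z (insertLeft x y z t))) =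
        insertRight y z x (D.a (mapL D.c.toLinearMap D.c_B Λ (D.a t))) := by
    rw [← h.associator, h.associator X Y Z]
    refine congrArg _ ?_
    generalize D.a t = s
    induction s using Tens.induction with
    | tmul p q => exact h.braiding X (ModuleCat.of R (Λ.Wedge Y Z)) p x (Λ.wtmul q y z)
    | add s s' hs hs' => simp only [map_add, hs, hs']
  have right (X Y Z : ModuleCat.{u} R) (x : X) (y : Y) (z : Z) (t : Λ.T₂ Λ) :
      Λ.wedgeMap LinearMap.id (β X Z) (α Y X Z (Λ.wedgeMap (β X Y) LinearMap.id
        (insertLeft x y z t))) =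
      insertRight y z x (mapR Λ.act₁ D.c.toLinearMap
        (D.a (mapR Λ.act₂ D.c.toLinearMap t))) := by
    have step : Λ.wedgeMap (β X Y) LinearMap.id (insertLeft x y z t) =
        insertLeft y x z (mapR Λ.act₂ D.c.toLinearMap t) := by
      induction t using Tens.induction with
      | tmul p q => exact congrArg (fun s => Λ.wtmul p s z) (h.braiding X Y q x y)
      | add s s' hs hs' => simp only [map_add, hs, hs']
    rw [step, h.associator]
    generalize D.a (mapR Λ.act₂ D.c.toLinearMap t) = s
    induction s using Tens.induction with
    | tmul p q => exact congrArg (fun s => Λ.wtmul p y s) (h.braiding X Z q x z)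
    | add s s' hs hs' => simp only [map_add, hs, hs']
  constructor
  · intro hh X Y Z
    refine hom_ext_insertLeft fun x y z t => ?_
    exact (left X Y Z x y z t).trans ((congrArg (insertRight y z x)
      (LinearMap.congr_fun hh t).symm).trans (right X Y Z x y z t).symm)
  · intro hα
    let F := ModuleCat.of R R
    refine LinearMap.ext fun t => (insertRight_one_bijective Λ).1 ?_
    exact (right F F F (1 : R) (1 : R) (1 : R) t).symm.trans
      ((LinearMap.congr_fun (hα F F F) _).symm.trans (left F F F (1 : R) (1 : R) (1 : R) t))

lemma symmetry_iff (h : D.Induces α lu ru β) :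
    (∀ x, D.c (D.c x) = x) ↔ ∀ X Y : ModuleCat.{u} R, β Y X ∘ₗ β X Y = LinearMap.id := by
  have key (X Y : ModuleCat.{u} R) (p : Λ) (x : X) (y : Y) :
      β Y X (β X Y (Λ.wtmul p x y)) = Λ.wtmul (D.c (D.c p)) x y := by
    rw [h.braiding, h.braiding]
  constructor
  · intro hc X Y
    refine Λ.wedge_hom_ext fun p x y => ?_
    exact (key X Y p x y).trans (congrArg (fun q => Λ.wtmul q x y) (hc p))
  · intro hβ p
    let F := ModuleCat.of R R
    refine (tmulRight_tmulRight_one_bijective Λ).1 ?_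
    exact (key F F p (1 : R) (1 : R)).symm.trans (LinearMap.congr_fun (hβ F F) _)

end StructureMaps.Induces

end Coherence

/-! ### The right adjoint of `A ∧ -` -/

section Hom

variable {R : Type u} [Ring R]
variable {M : Type*} [AddCommGroup M] [Module R M]
variable {N : Type*} [AddCommGroup N] [Module R N]
variable {P : Type*} [AddCommGroup P] [Module R P]

/-- The left linear maps `M → P`, as a left `R`-module through the right action `ρ` on `M`:
`(r • f) m = f (m ⊙ r)`. -/
def RightHom (_ρ : RightAct R M) (P : Type*) [AddCommGroup P] [Module R P] : Type _ :=
  M →ₗ[R] P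

namespace RightHom

instance (ρ : RightAct R M) : AddCommGroup (RightHom ρ P) :=
  inferInstanceAs (AddCommGroup (M →ₗ[R] P))

instance (ρ : RightAct R M) : FunLike (RightHom ρ P) M P :=
  inferInstanceAs (FunLike (M →ₗ[R] P) M P)

instance (ρ : RightAct R M) : LinearMapClass (RightHom ρ P) R M P :=
  inferInstanceAs (LinearMapClass (M →ₗ[R] P) R M P)

@[ext]
lemma ext {ρ : RightAct R M} {f g : RightHom ρ P} (h : ∀ m, f m = g m) : f = g :=
  LinearMap.ext h

/-- The element of `RightHom ρ P` given by a left linear map. -/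
def of (ρ : RightAct R M) (f : M →ₗ[R] P) : RightHom ρ P := f

@[simp]
lemma of_apply (ρ : RightAct R M) (f : M →ₗ[R] P) (m : M) : of ρ f m = f m := rfl

@[simp]
lemma add_apply {ρ : RightAct R M} (f g : RightHom ρ P) (m : M) : (f + g) m = f m + g m := rfl

@[simp]
lemma zero_apply {ρ : RightAct R M} (m : M) : (0 : RightHom ρ P) m = 0 := rfl

instance (ρ : RightAct R M) : SMul R (RightHom ρ P) where
  smul r f := LinearMap.comp f (ρ (op r))

@[simp]
lemma smul_apply {ρ : RightAct R M} (r : R) (f : RightHom ρ P) (m : M) :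
    (r • f) m = f (ρ (op r) m) := rfl

instance (ρ : RightAct R M) : Module R (RightHom ρ P) where
  one_smul f := by ext m; simp
  mul_smul r s f := by ext m; simp
  smul_zero r := by ext m; simp
  smul_add r f g := by ext m; simp
  add_smul r s f := by ext m; simp
  zero_smul f := by ext m; simp

end RightHom

/-- The tensor-hom adjunction over a noncommutative ring. -/
def tensHomEquiv (ρ : RightAct R M) (N P : Type*) [AddCommGroup N] [Module R N] [AddCommGroup P]
    [Module R P] : (Tens ρ N →ₗ[R] P) ≃ (N →ₗ[R] RightHom ρ P) where
  toFun f :=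
    { toFun := fun n => RightHom.of ρ (f ∘ₗ Tens.tmulRight ρ n)
      map_add' := fun n n' => by ext m; simp [Tens.tmul_add]
      map_smul' := fun r n => by ext m; simp [Tens.act_tmul] }
  invFun g := Tens.lift (fun m n => g n m)
    (fun m m' n => map_add (g n) m m')
    (fun m n n' => by rw [map_add, RightHom.add_apply])
    (fun r m n => map_smul (g n) r m)
    (fun r m n => by rw [map_smul, RightHom.smul_apply])
  left_inv f := Tens.hom_ext fun _ _ => rfl
  right_inv g := rfl

end Hom

/-! ### The monoidal structure given by coherent data -/

section OfData

open Tens TwoFoldBimodule MonoidalCategory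

variable {R : Type u} [Ring R] {Λ : TwoFoldBimodule R}

lemma Tens.mapR_id {M : Type*} [AddCommGroup M] [Module R M] (ρ : RightAct R M) (N : Type*)
    [AddCommGroup N] [Module R N] :
    mapR ρ (LinearMap.id : N →ₗ[R] N) = LinearMap.id :=
  Tens.hom_ext fun _ _ => rfl

lemma Carries.symm {M M' : Type*} [AddCommGroup M] [Module R M] [AddCommGroup M'] [Module R M']
    {e : M ≃ₗ[R] M'} {ρ : RightAct R M} {ρ' : RightAct R M'} (h : Carries e.toLinearMap ρ ρ') :
    Carries e.symm.toLinearMap ρ' ρ := fun r x => e.injective (by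
  have := h r (e.symm x)
  simp only [LinearEquiv.coe_coe, LinearEquiv.apply_symm_apply] at this ⊢
  exact this.symm)

lemma bimap_wedge {A A' B B' : ModuleCat.{u} R} (f : A ⟶ A') (g : B ⟶ B') :
    bimap Λ.wedge f g = ModuleCat.ofHom (Λ.wedgeMap f.hom g.hom) :=
  ModuleCat.hom_ext (Λ.wedge_hom_ext fun _ _ _ => rfl)

lemma bimap_bimap_wedge {A A' B B' C C' : ModuleCat.{u} R} (f : A ⟶ A') (g : B ⟶ B')
    (h : C ⟶ C') : bimap Λ.wedge (bimap Λ.wedge f g) h =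
      ModuleCat.ofHom (Λ.wedgeMap (Λ.wedgeMap f.hom g.hom) h.hom) :=
  (bimap_wedge (bimap Λ.wedge f g) h).trans
    (congrArg (fun k => ModuleCat.ofHom (Λ.wedgeMap (ModuleCat.Hom.hom k) h.hom))
      (bimap_wedge f g))

lemma bimap_wedge_bimap {A A' B B' C C' : ModuleCat.{u} R} (f : A ⟶ A') (g : B ⟶ B')
    (h : C ⟶ C') : bimap Λ.wedge f (bimap Λ.wedge g h) =
      ModuleCat.ofHom (Λ.wedgeMap f.hom (Λ.wedgeMap g.hom h.hom)) :=
  (bimap_wedge f (bimap Λ.wedge g h)).trans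
    (congrArg (fun k => ModuleCat.ofHom (Λ.wedgeMap f.hom (ModuleCat.Hom.hom k)))
      (bimap_wedge g h))

/-- For a symmetric family of commutativity isomorphisms the second hexagon identity follows from
the first: the second one for `X, Y, Z` is the inverse of the first one for `Z, X, Y`. -/
lemma hexagon_reverse_of_forward {C : Type*} [Category* C] [MonoidalCategory C]
    (β : ∀ X Y : C, X ⊗ Y ≅ Y ⊗ X) (symm : ∀ X Y, (β X Y).hom ≫ (β Y X).hom = 𝟙 _)
    (hexagon : ∀ X Y Z, (α_ X Y Z).hom ≫ (β X (Y ⊗ Z)).hom ≫ (α_ Y Z X).hom =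
      (β X Y).hom ▷ Z ≫ (α_ Y X Z).hom ≫ Y ◁ (β X Z).hom) (X Y Z : C) :
    (α_ X Y Z).inv ≫ (β (X ⊗ Y) Z).hom ≫ (α_ Z X Y).inv =
      X ◁ (β Y Z).hom ≫ (α_ X Z Y).inv ≫ (β X Z).hom ▷ Y := by
  have h (X Y : C) : (β X Y).hom = (β Y X).inv := (Iso.eq_inv_comp _).2 (symm Y X) |>.trans
    (Category.comp_id _)
  rw [h (X ⊗ Y) Z, h Y Z, h X Z]
  simpa using IsIso.inv_eq_inv.2 (hexagon Z X Y)

namespace StructureMaps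

variable (D : StructureMaps Λ)

/-- The map `a ⊗ 1 ⊗ 1 ⊗ 1 : (A ∧ B) ∧ C → A ∧ (B ∧ C)`, as an isomorphism. -/
def assocEquiv (A B C : Type u) [AddCommGroup A] [Module R A] [AddCommGroup B] [Module R B]
    [AddCommGroup C] [Module R C] :
    Λ.Wedge (Λ.Wedge A B) C ≃ₗ[R] Λ.Wedge A (Λ.Wedge B C) :=
  LinearEquiv.ofLinearMap
    (liftLeft (fun x y z => insertRight x y z ∘ₗ D.a.toLinearMap)
      (insertRight_balanced.comp D.a_A D.a_B D.a_C))
    (liftRight (fun x y z => insertLeft x y z ∘ₗ D.a.symm.toLinearMap)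
      (insertLeft_balanced.comp D.a_A.symm D.a_B.symm D.a_C.symm))
    (hom_ext_insertRight fun x y z t => by
      rw [LinearMap.comp_apply, liftRight_insertRight, LinearMap.comp_apply, liftLeft_insertLeft]
      simp)
    (hom_ext_insertLeft fun x y z t => by
      rw [LinearMap.comp_apply, liftLeft_insertLeft, LinearMap.comp_apply, liftRight_insertRight]
      simp)

lemma assocEquiv_insertLeft {A B C : Type u} [AddCommGroup A] [Module R A] [AddCommGroup B]
    [Module R B] [AddCommGroup C] [Module R C] (x : A) (y : B) (z : C) (t : Λ.T₂ Λ) :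
    D.assocEquiv A B C (insertLeft x y z t) = insertRight x y z (D.a t) :=
  liftLeft_insertLeft _ (insertRight_balanced.comp D.a_A D.a_B D.a_C) x y z t

/-- The map `K ∧ A → A`, `t ⊗ x ↦ ℓ t • x`, as an isomorphism. -/
def leftUnitEquiv (A : Type u) [AddCommGroup A] [Module R A] : Λ.Wedge D.K A ≃ₗ[R] A :=
  LinearEquiv.ofLinearMap
    (Tens.lift (fun t x => D.ℓ t • x)
      (fun t t' x => by rw [map_add, add_smul])
      (fun t x x' => smul_add _ x x')
      (fun r t x => by rw [map_smul, smul_assoc])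
      (fun r t x => by
        have h : D.ℓ (Λ.T₂act D.K (op r) t) = D.ℓ t * r := D.ℓ_B (op r) t
        rw [h, mul_smul]))
    { toFun := fun x => tmul (Λ.T₂act D.K) (D.ℓ.symm 1) x
      map_add' := tmul_add _ _
      map_smul' := fun r x => by
        have h : Λ.T₂act D.K (op r) (D.ℓ.symm 1) = r • D.ℓ.symm 1 := by
          rw [← map_smul]
          refine (D.ℓ_B.symm (op r) 1).symm.trans (congrArg D.ℓ.symm ?_)
          change (1 : R) * r = r * 1
          rw [one_mul, mul_one]
        rw [← act_tmul, h, smul_tmul, RingHom.id_apply] }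
    (LinearMap.ext fun x => by
      change D.ℓ (D.ℓ.symm 1) • x = x
      rw [LinearEquiv.apply_symm_apply, one_smul])
    (Tens.hom_ext fun t x => by
      change tmul (Λ.T₂act D.K) (D.ℓ.symm 1) (D.ℓ t • x) = tmul (Λ.T₂act D.K) t x
      rw [← act_tmul]
      refine congrArg (fun s => tmul (Λ.T₂act D.K) s x) (D.ℓ.injective ?_)
      refine (D.ℓ_B (op (D.ℓ t)) (D.ℓ.symm 1)).trans ?_
      change D.ℓ (D.ℓ.symm 1) * D.ℓ t = D.ℓ t
      rw [LinearEquiv.apply_symm_apply, one_mul])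

/-- The map `A ∧ B → B ∧ A`, `p ⊗ x ⊗ y ↦ c p ⊗ y ⊗ x`. -/
def braidingHom (A B : Type u) [AddCommGroup A] [Module R A] [AddCommGroup B] [Module R B] :
    Λ.Wedge A B →ₗ[R] Λ.Wedge B A :=
  wedgeLift (fun p x y => Λ.wtmul (D.c p) y x)
    { add₁ := fun p p' x y => by rw [map_add, add_wtmul]
      add₂ := fun p x x' y => wtmul_add_right _ _ _ _
      add₃ := fun p x y y' => wtmul_add_left _ _ _ _
      act₁ := fun r p x y =>
        (congrArg (fun q => Λ.wtmul q y x) (D.c_B (op r) p)).trans (wtmul_act₂ r (D.c p) y x)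
      act₂ := fun r p x y =>
        (congrArg (fun q => Λ.wtmul q y x) (D.c_A (op r) p)).trans (wtmul_act₁ r (D.c p) y x) }
    (fun r p x y => by rw [map_smul, smul_wtmul])

end StructureMaps

namespace CoherentData

variable (D : CoherentData Λ)

/-- The isomorphism `A ∧ B → B ∧ A`, `p ⊗ x ⊗ y ↦ c p ⊗ y ⊗ x`. -/
def braidingEquiv (A B : Type u) [AddCommGroup A] [Module R A] [AddCommGroup B] [Module R B] :
    Λ.Wedge A B ≃ₗ[R] Λ.Wedge B A :=
  LinearEquiv.ofLinearMap (D.braidingHom A B) (D.braidingHom B A)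
    (Λ.wedge_hom_ext fun p x y => congrArg (fun q => Λ.wtmul q x y) (D.c_c p))
    (Λ.wedge_hom_ext fun p x y => congrArg (fun q => Λ.wtmul q x y) (D.c_c p))

lemma induces : D.Induces (fun A B C => (D.assocEquiv A B C).toLinearMap)
    (fun A => (D.leftUnitEquiv A).toLinearMap)
    (fun A => ((D.braidingEquiv A D.K).trans (D.leftUnitEquiv A)).toLinearMap)
    (fun A B => (D.braidingEquiv A B).toLinearMap) where
  associator _ _ _ x y z t := D.assocEquiv_insertLeft x y z t
  leftUnitor _ _ _ _ := rfl
  rightUnitor _ _ _ _ := rfl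
  braiding _ _ _ _ _ := rfl

/-- The monoidal structure on left `R`-modules given by coherent data. -/
def toMonoidalOn : MonoidalOn Λ.wedge where
  unit := D.K
  associator A B C := (D.assocEquiv A B C).toModuleIso
  leftUnitor A := (D.leftUnitEquiv A).toModuleIso
  rightUnitor A := ((D.braidingEquiv A D.K).trans (D.leftUnitEquiv A)).toModuleIso
  associator_naturality {A A' B B' C C'} f g h := by
    rw [bimap_bimap_wedge, bimap_wedge_bimap]
    refine ModuleCat.hom_ext (hom_ext_insertLeft fun x y z t => ?_)
    change D.assocEquiv A' B' C' (Λ.wedgeMap (Λ.wedgeMap f.hom g.hom) h.hom (insertLeft x y z t)) =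
      Λ.wedgeMap f.hom (Λ.wedgeMap g.hom h.hom) (D.assocEquiv A B C (insertLeft x y z t))
    rw [wedgeMap_insertLeft, D.assocEquiv_insertLeft, D.assocEquiv_insertLeft,
      wedgeMap_insertRight]
  leftUnitor_naturality f := ModuleCat.hom_ext (Λ.wedge_hom_ext fun p k x =>
    (map_smul f.hom (D.ℓ (tmul Λ.act₂ p k)) x).symm)
  rightUnitor_naturality f := ModuleCat.hom_ext (Λ.wedge_hom_ext fun p x k =>
    (map_smul f.hom (D.ℓ (tmul Λ.act₂ (D.c p) k)) x).symm)
  pentagon W X Y Z :=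
    ModuleCat.hom_ext (D.induces.pentagon_iff.1 D.pentagon W X Y Z).symm
  triangle X Y := ModuleCat.hom_ext (D.induces.triangle_iff.1 D.unit_compatibility X Y)

/-- The commutativity isomorphisms given by coherent data form a symmetry. -/
@[reducible]
def toSymmetricCategory :
    @SymmetricCategory (ModuleCat.{u} R) _ D.toMonoidalOn.toMonoidalCategory :=
  letI := D.toMonoidalOn.toMonoidalCategory
  have hexagon (X Y Z : ModuleCat.{u} R) :
      (D.toMonoidalOn.associator X Y Z).hom ≫
        (D.braidingEquiv X (Λ.Wedge Y Z)).toModuleIso.hom ≫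
          (D.toMonoidalOn.associator Y Z X).hom =
      (Λ.wedge.map (D.braidingEquiv X Y).toModuleIso.hom).app Z ≫
        (D.toMonoidalOn.associator Y X Z).hom ≫
          (Λ.wedge.obj Y).map (D.braidingEquiv X Z).toModuleIso.hom :=
    ModuleCat.hom_ext (D.induces.hexagon_iff.1 D.hexagon X Y Z)
  have symm (X Y : ModuleCat.{u} R) : (D.braidingEquiv X Y).toModuleIso.hom ≫
      (D.braidingEquiv Y X).toModuleIso.hom = 𝟙 _ :=
    ModuleCat.hom_ext (D.induces.symmetry_iff.1 D.c_c X Y)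
  { braiding := fun X Y => (D.braidingEquiv X Y).toModuleIso
    braiding_naturality_right := fun _ _ _ _ =>
      ModuleCat.hom_ext (Λ.wedge_hom_ext fun _ _ _ => rfl)
    braiding_naturality_left := fun _ _ =>
      ModuleCat.hom_ext (Λ.wedge_hom_ext fun _ _ _ => rfl)
    hexagon_forward := hexagon
    hexagon_reverse := hexagon_reverse_of_forward (C := ModuleCat.{u} R)
      (fun X Y => (D.braidingEquiv X Y).toModuleIso) symm hexagon
    symmetry := symm }

/-- The functor `A ∧ -` has the right adjoint `Hom_R(Λ ⊗ A, -)`. -/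
@[reducible]
def toMonoidalClosed :
    @MonoidalClosed (ModuleCat.{u} R) _ D.toMonoidalOn.toMonoidalCategory :=
  letI := D.toMonoidalOn.toMonoidalCategory
  { closed := fun A =>
      let e (B C : ModuleCat.{u} R) : ((Λ.wedge.obj A).obj B ⟶ C) ≃
          (B ⟶ ModuleCat.of R (RightHom (Λ.T₂act A) C)) :=
        (ModuleCat.homEquiv.trans (tensHomEquiv (Λ.T₂act A) B C)).trans ModuleCat.homEquiv.symm
      have he : ∀ B' B C f g, e B' C ((Λ.wedge.obj A).map f ≫ g) = f ≫ e B C g :=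
        fun _ _ _ f g => ModuleCat.hom_ext (LinearMap.ext fun x =>
          RightHom.ext (ρ := Λ.T₂act A) fun t =>
            congrArg (fun s => g.hom (tmul (Λ.T₂act A) s (f.hom x)))
              (LinearMap.congr_fun (mapR_id Λ.act₂ A) t))
      ⟨Adjunction.rightAdjointOfEquiv e he, Adjunction.adjunctionOfEquivRight e he⟩ }

/-- The additive closed symmetric monoidal structure given by coherent data. -/
def toStructure : AdditiveClosedSymmetricMonoidalOn Λ.wedge where
  toMonoidalOn := D.toMonoidalOn
  symmetric := D.toSymmetricCategory
  additive :=
    letI := D.toMonoidalOn.toMonoidalCategory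
    { whiskerLeft_zero := ModuleCat.hom_ext (Λ.wedge_hom_ext fun p x y => tmul_zero _)
      zero_whiskerRight := ModuleCat.hom_ext (Λ.wedge_hom_ext fun p x y => by
        change tmul _ (tmul _ p 0) y = 0
        rw [tmul_zero, zero_tmul])
      whiskerLeft_add := fun f g => ModuleCat.hom_ext (Λ.wedge_hom_ext fun p x y =>
        wtmul_add_right p x (f y) (g y))
      add_whiskerRight := fun f g => ModuleCat.hom_ext (Λ.wedge_hom_ext fun p x y =>
        wtmul_add_left p (f x) (g x) y) }
  closed := ⟨D.toMonoidalClosed⟩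

lemma corresponds_toStructure : Corresponds D.toStructure D where
  associator A B C x y z t := D.induces.associator A B C x y z t
  unit_eq := rfl
  leftUnitor _ _ _ _ := rfl
  braiding _ _ _ _ _ := rfl

end CoherentData

end OfData

/-! ### The coherent data of a monoidal structure -/

section OfStructure

open Tens TwoFoldBimodule

variable {R : Type u} [Ring R] {Λ : TwoFoldBimodule R}

namespace AdditiveClosedSymmetricMonoidalOn

/-- In a symmetric monoidal category the right unit isomorphism is determined by the left one and
the commutativity isomorphism; hence the data need no right unit isomorphism. -/
lemma rightUnitor_eq {F : ModuleCat.{u} R ⥤ ModuleCat.{u} R ⥤ ModuleCat.{u} R}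
    (S : AdditiveClosedSymmetricMonoidalOn F) (X : ModuleCat.{u} R) :
    (S.rightUnitor X).hom = (S.braiding X S.unit).hom ≫ (S.leftUnitor X).hom :=
  letI := S.toMonoidalCategory
  letI := S.symmetric
  (braiding_leftUnitor X).symm

lemma braiding_naturality {F : ModuleCat.{u} R ⥤ ModuleCat.{u} R ⥤ ModuleCat.{u} R}
    (S : AdditiveClosedSymmetricMonoidalOn F) {X X' Y Y' : ModuleCat.{u} R} (f : X ⟶ X')
    (g : Y ⟶ Y') :
    bimap F f g ≫ (S.braiding X' Y').hom = (S.braiding X Y).hom ≫ bimap F g f := by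
  let := S.toMonoidalCategory
  let := S.symmetric
  exact BraidedCategory.braiding_naturality f g

/-- Additivity, closedness and the axioms of a symmetry are properties. -/
lemma ext_of_braiding_eq {C : Type v} [Category.{u} C] [Preadditive C] {F : C ⥤ C ⥤ C}
    {S S' : AdditiveClosedSymmetricMonoidalOn F} (h : S.toMonoidalOn = S'.toMonoidalOn)
    (hb : ∀ X Y, S.braiding X Y = S'.braiding X Y) : S = S' := by
  obtain ⟨S, s, _, _⟩ := S
  obtain ⟨S', s', _, _⟩ := S'
  obtain rfl : S = S' := h
  obtain rfl : s = s' := by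
    obtain @⟨⟨b, _, _, _, _⟩, _⟩ := s
    obtain @⟨⟨b', _, _, _, _⟩, _⟩ := s'
    obtain rfl : b = b' := funext fun X => funext fun Y => hb X Y
    rfl
  rfl

variable (S : AdditiveClosedSymmetricMonoidalOn Λ.wedge)

/-- The associativity isomorphism as an isomorphism of the underlying modules. -/
def α (A B C : ModuleCat.{u} R) : Λ.Wedge (Λ.Wedge A B) C ≃ₗ[R] Λ.Wedge A (Λ.Wedge B C) :=
  (S.associator A B C).toLinearEquiv

/-- The left unit isomorphism as an isomorphism of the underlying modules. -/
def lu (A : ModuleCat.{u} R) : Λ.Wedge S.unit A ≃ₗ[R] A :=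
  (S.leftUnitor A).toLinearEquiv

/-- The commutativity isomorphism as an isomorphism of the underlying modules. -/
def β (A B : ModuleCat.{u} R) : Λ.Wedge A B ≃ₗ[R] Λ.Wedge B A :=
  (S.braiding A B).toLinearEquiv

lemma α_wedgeMap {A A' B B' C C' : ModuleCat.{u} R} (f : A →ₗ[R] A') (g : B →ₗ[R] B')
    (h : C →ₗ[R] C') (t : Λ.Wedge (Λ.Wedge A B) C) :
    S.α A' B' C' (Λ.wedgeMap (Λ.wedgeMap f g) h t) =
      Λ.wedgeMap f (Λ.wedgeMap g h) (S.α A B C t) := by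
  have := S.associator_naturality (ModuleCat.ofHom f) (ModuleCat.ofHom g) (ModuleCat.ofHom h)
  rw [bimap_bimap_wedge, bimap_wedge_bimap] at this
  exact LinearMap.congr_fun (congrArg ModuleCat.Hom.hom this) t

lemma lu_wedgeMap {A B : ModuleCat.{u} R} (f : A →ₗ[R] B) (t : Λ.Wedge S.unit A) :
    S.lu B (Λ.wedgeMap LinearMap.id f t) = f (S.lu A t) :=
  LinearMap.congr_fun (congrArg ModuleCat.Hom.hom (S.leftUnitor_naturality (ModuleCat.ofHom f))) t

lemma β_wedgeMap {A A' B B' : ModuleCat.{u} R} (f : A →ₗ[R] A') (g : B →ₗ[R] B')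
    (t : Λ.Wedge A B) : S.β A' B' (Λ.wedgeMap f g t) = Λ.wedgeMap g f (S.β A B t) := by
  have := S.braiding_naturality (ModuleCat.ofHom f) (ModuleCat.ofHom g)
  rw [bimap_wedge, bimap_wedge] at this
  exact LinearMap.congr_fun (congrArg ModuleCat.Hom.hom this) t

/-- The map `a`: the associativity isomorphism for the modules `R, R, R`, transported along
`insertLeft 1 1 1` and `insertRight 1 1 1`. -/
def aEquiv : Λ.T₂ Λ ≃ₗ[R] Λ.T₁ Λ :=
  (LinearEquiv.ofBijective _ (insertLeft_one_bijective Λ)).trans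
    ((S.α (ModuleCat.of R R) (ModuleCat.of R R) (ModuleCat.of R R)).trans
      (LinearEquiv.ofBijective _ (insertRight_one_bijective Λ)).symm)

/-- The map `ℓ`: the left unit isomorphism for the module `R`, transported along the isomorphism
`Λ ⊗ K → K ∧ R`, `t ↦ t ⊗ 1`. -/
def ℓEquiv : Λ.T₂ S.unit ≃ₗ[R] R :=
  (LinearEquiv.ofBijective _ (tmulRight_one_bijective (Λ.T₂act S.unit))).trans
    (S.lu (ModuleCat.of R R))

/-- The map `c`: the commutativity isomorphism for the modules `R, R`, transported along the
isomorphism `Λ → R ∧ R`, `p ↦ p ⊗ 1 ⊗ 1`. -/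
def cEquiv : Λ ≃ₗ[R] Λ :=
  (LinearEquiv.ofBijective _ (tmulRight_tmulRight_one_bijective Λ)).trans
    ((S.β (ModuleCat.of R R) (ModuleCat.of R R)).trans
      (LinearEquiv.ofBijective _ (tmulRight_tmulRight_one_bijective Λ)).symm)

/-- Naturality with respect to the maps `R → A`, `1 ↦ x`, and their analogues for `y` and `z`,
reduces the associativity isomorphism to its component at `R, R, R`. -/
lemma α_insertLeft (A B C : ModuleCat.{u} R) (x : A) (y : B) (z : C) (t : Λ.T₂ Λ) :
    S.α A B C (insertLeft x y z t) = insertRight x y z (S.aEquiv t) := by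
  have h : insertRight (1 : R) (1 : R) (1 : R) (S.aEquiv t) =
      S.α (ModuleCat.of R R) (ModuleCat.of R R) (ModuleCat.of R R)
        (insertLeft (1 : R) (1 : R) (1 : R) t) :=
    (LinearEquiv.ofBijective _ (insertRight_one_bijective Λ)).apply_symm_apply _
  have h' := S.α_wedgeMap (A := ModuleCat.of R R) (B := ModuleCat.of R R) (C := ModuleCat.of R R)
    (LinearMap.toSpanSingleton R A x) (LinearMap.toSpanSingleton R B y)
    (LinearMap.toSpanSingleton R C z) (insertLeft (1 : R) (1 : R) (1 : R) t)
  rw [← h, wedgeMap_insertLeft, wedgeMap_insertRight] at h'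
  simpa only [LinearMap.toSpanSingleton_apply, one_smul] using h'

lemma lu_tmul (A : ModuleCat.{u} R) (t : Λ.T₂ S.unit) (x : A) :
    S.lu A (tmul _ t x) = S.ℓEquiv t • x := by
  have h := S.lu_wedgeMap (A := ModuleCat.of R R) (LinearMap.toSpanSingleton R A x)
    (tmul _ t (1 : R))
  have h' : Λ.wedgeMap LinearMap.id (LinearMap.toSpanSingleton R A x) (tmul _ t (1 : R)) =
      tmul (Λ.T₂act S.unit) t x :=
    congrArg₂ (tmul (Λ.T₂act S.unit)) (LinearMap.congr_fun (mapR_id Λ.act₂ S.unit) t)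
      (one_smul R x)
  exact (congrArg (S.lu A) h').symm.trans h

lemma β_wtmul (A B : ModuleCat.{u} R) (p : Λ) (x : A) (y : B) :
    S.β A B (Λ.wtmul p x y) = Λ.wtmul (S.cEquiv p) y x := by
  have h : Λ.wtmul (S.cEquiv p) (1 : R) (1 : R) =
      S.β (ModuleCat.of R R) (ModuleCat.of R R) (Λ.wtmul p (1 : R) (1 : R)) :=
    (LinearEquiv.ofBijective _ (tmulRight_tmulRight_one_bijective Λ)).apply_symm_apply _
  have h' := S.β_wedgeMap (A := ModuleCat.of R R) (B := ModuleCat.of R R)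
    (LinearMap.toSpanSingleton R A x) (LinearMap.toSpanSingleton R B y)
    (Λ.wtmul p (1 : R) (1 : R))
  rw [← h, wedgeMap_wtmul, wedgeMap_wtmul] at h'
  simpa only [LinearMap.toSpanSingleton_apply, one_smul] using h'

/-- The maps `a`, `ℓ`, `c` of a monoidal structure. -/
def toStructureMaps : StructureMaps Λ :=
  let F := ModuleCat.of R R
  { a := S.aEquiv
    a_A := fun r t => (insertRight_one_bijective Λ).1 <| by
      have h := S.α_insertLeft F F F (1 : R) (1 : R) (1 : R) (onRight Λ.act₂ Λ.act₂ r t)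
      exact h.symm.trans ((congrArg (S.α F F F) (insertLeft_balanced.act₁ r.unop _ _ _ t)).trans
        ((S.α_insertLeft F F F _ _ _ t).trans (insertRight_balanced.act₁ r.unop _ _ _ _).symm))
    a_B := fun r t => (insertRight_one_bijective Λ).1 <| by
      have h := S.α_insertLeft F F F (1 : R) (1 : R) (1 : R) (onRight Λ.act₂ Λ.act₁ r t)
      exact h.symm.trans ((congrArg (S.α F F F) (insertLeft_balanced.act₂ r.unop _ _ _ t)).trans
        ((S.α_insertLeft F F F _ _ _ t).trans (insertRight_balanced.act₂ r.unop _ _ _ _).symm))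
    a_C := fun r t => (insertRight_one_bijective Λ).1 <| by
      have h := S.α_insertLeft F F F (1 : R) (1 : R) (1 : R) (Λ.T₂act Λ r t)
      exact h.symm.trans ((congrArg (S.α F F F) (insertLeft_balanced.act₃ r.unop _ _ _ t)).trans
        ((S.α_insertLeft F F F _ _ _ t).trans (insertRight_balanced.act₃ r.unop _ _ _ _).symm))
    K := S.unit
    ℓ := S.ℓEquiv
    ℓ_B := fun r t => by
      change S.lu F (tmul _ (Λ.T₂act S.unit r t) (1 : R)) = S.ℓEquiv t * r.unop
      refine (congrArg (S.lu F) (act_tmul (Λ.T₂act S.unit) r.unop t (1 : R))).trans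
        ((S.lu_tmul F t (r.unop * 1 : R)).trans ?_)
      rw [mul_one]; rfl
    c := S.cEquiv
    c_B := fun r p => (tmulRight_tmulRight_one_bijective Λ).1 <| by
      have h := S.β_wtmul F F (Λ.act₁ r p) (1 : R) (1 : R)
      exact h.symm.trans ((congrArg (S.β F F) (wtmul_act₁ r.unop p _ _)).trans
        ((S.β_wtmul F F p _ _).trans (wtmul_act₂ r.unop _ _ _).symm))
    c_A := fun r p => (tmulRight_tmulRight_one_bijective Λ).1 <| by
      have h := S.β_wtmul F F (Λ.act₂ r p) (1 : R) (1 : R)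
      exact h.symm.trans ((congrArg (S.β F F) (wtmul_act₂ r.unop p _ _)).trans
        ((S.β_wtmul F F p _ _).trans (wtmul_act₁ r.unop _ _ _).symm)) }

lemma induces : S.toStructureMaps.Induces (fun A B C => (S.α A B C).toLinearMap)
    (fun A => (S.lu A).toLinearMap) (fun A => (S.rightUnitor A).hom.hom)
    (fun A B => (S.β A B).toLinearMap) where
  associator := S.α_insertLeft
  leftUnitor A p k x := S.lu_tmul A (tmul _ p k) x
  rightUnitor A p x k := by
    rw [S.rightUnitor_eq]
    exact (congrArg (S.lu A) (S.β_wtmul A S.unit p x k)).trans (S.lu_tmul A (tmul _ _ k) x)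
  braiding := S.β_wtmul

/-- The coherent data of a monoidal structure. -/
def toCoherentData : CoherentData Λ where
  toStructureMaps := S.toStructureMaps
  pentagon := S.induces.pentagon_iff.2 fun W X Y Z =>
    (congrArg ModuleCat.Hom.hom (S.pentagon W X Y Z)).symm
  unit_compatibility := S.induces.triangle_iff.2 fun X Y =>
    congrArg ModuleCat.Hom.hom (S.triangle X Y)
  hexagon := S.induces.hexagon_iff.2 fun X Y Z =>
    letI := S.toMonoidalCategory
    letI := S.symmetric
    congrArg ModuleCat.Hom.hom (BraidedCategory.hexagon_forward X Y Z)
  c_c := S.induces.symmetry_iff.2 fun X Y =>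
    letI := S.toMonoidalCategory
    letI := S.symmetric
    congrArg ModuleCat.Hom.hom (SymmetricCategory.symmetry X Y)

lemma corresponds_toCoherentData : Corresponds S S.toCoherentData where
  associator := S.α_insertLeft
  unit_eq := rfl
  leftUnitor A p k x := S.lu_tmul A (tmul _ p k) x
  braiding := S.β_wtmul

end AdditiveClosedSymmetricMonoidalOn

/-! ### Uniqueness -/

lemma Corresponds.data_unique {S : AdditiveClosedSymmetricMonoidalOn Λ.wedge}
    {D D' : CoherentData Λ} (h : Corresponds S D) (h' : Corresponds S D') : D = D' := by
  obtain ⟨ha, hK, hl, hc⟩ := h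
  obtain ⟨ha', hK', hl', hc'⟩ := h'
  obtain ⟨⟨a, _, _, _, K, l, _, c, _, _⟩, _, _, _, _⟩ := D
  obtain ⟨⟨a', _, _, _, K', l', _, c', _, _⟩, _, _, _, _⟩ := D'
  obtain ⟨⟨U, _, lu, _, _, _, _, _, _⟩, _, _, _⟩ := S
  dsimp only at ha hK hl hc ha' hK' hl' hc'
  subst hK hK'
  let F := ModuleCat.of R R
  obtain rfl : a = a' := LinearEquiv.ext fun t => (insertRight_one_bijective Λ).1
    ((ha F F F (1 : R) (1 : R) (1 : R) t).symm.trans (ha' F F F (1 : R) (1 : R) (1 : R) t))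
  obtain rfl : l = l' := by
    refine LinearEquiv.toLinearMap_injective (Tens.hom_ext fun p k => ?_)
    have e := (hl F p k (1 : R)).symm.trans (hl' F p k (1 : R))
    exact (mul_one _).symm.trans (e.trans (mul_one _))
  obtain rfl : c = c' := LinearEquiv.ext fun p => (tmulRight_tmulRight_one_bijective Λ).1
    ((hc F F p (1 : R) (1 : R)).symm.trans (hc' F F p (1 : R) (1 : R)))
  rfl

lemma eqToHom_eqToHom_symm {K U : ModuleCat.{u} R} (h : K = U) (k : U) :
    eqToHom h (eqToHom h.symm k) = k := by
  subst h
  rfl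

lemma Corresponds.structure_unique {S S' : AdditiveClosedSymmetricMonoidalOn Λ.wedge}
    {D : CoherentData Λ} (h : Corresponds S D) (h' : Corresponds S' D) : S = S' := by
  have hb (X Y) : S.braiding X Y = S'.braiding X Y :=
    Iso.ext (ModuleCat.hom_ext (Λ.wedge_hom_ext fun p x y =>
      (h.braiding X Y p x y).trans (h'.braiding X Y p x y).symm))
  refine AdditiveClosedSymmetricMonoidalOn.ext_of_braiding_eq ?_ hb
  have hr := S.rightUnitor_eq
  have hr' := S'.rightUnitor_eq
  simp only [hb] at hr
  obtain ⟨ha, hK, hl, -⟩ := h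
  obtain ⟨ha', hK', hl', -⟩ := h'
  clear hb
  generalize S'.braiding = b at hr hr'
  generalize S.toMonoidalOn = M at *
  generalize S'.toMonoidalOn = M' at *
  obtain ⟨U, a, l, r, _, _, _, _, _⟩ := M
  obtain ⟨U', a', l', r', _, _, _, _, _⟩ := M'
  dsimp only at *
  obtain rfl : U = U' := hK.symm.trans hK'
  obtain rfl : a = a' := funext fun A => funext fun B => funext fun C =>
    Iso.ext (ModuleCat.hom_ext (hom_ext_insertLeft fun x y z t =>
      (ha A B C x y z t).trans (ha' A B C x y z t).symm))
  obtain rfl : l = l' := funext fun A =>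
    Iso.ext (ModuleCat.hom_ext (Λ.wedge_hom_ext fun p k x => by
      obtain ⟨k, rfl⟩ : ∃ k' : D.K, eqToHom hK k' = k :=
        ⟨eqToHom hK.symm k, eqToHom_eqToHom_symm hK k⟩
      exact (hl A p k x).trans (hl' A p k x).symm))
  obtain rfl : r = r' := funext fun A => Iso.ext ((hr A).trans (hr' A).symm)
  rfl

end OfStructure

end NFold

end

theorem theorem2p2 (R : Type u) [Ring R] (Λ : NFold.TwoFoldBimodule R) :
    ∃ e : NFold.AdditiveClosedSymmetricMonoidalOn Λ.wedge ≃ NFold.CoherentData Λ,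
      ∀ (S : NFold.AdditiveClosedSymmetricMonoidalOn Λ.wedge) (D : NFold.CoherentData Λ),
        e S = D ↔ NFold.Corresponds S D := by
  refine ⟨{ toFun := fun S => S.toCoherentData
            invFun := fun D => D.toStructure
            left_inv := fun S => ?_
            right_inv := fun D => ?_ }, fun S D => ⟨?_, fun h => ?_⟩⟩
  · exact S.toCoherentData.corresponds_toStructure.structure_unique S.corresponds_toCoherentData
  · exact D.toStructure.corresponds_toCoherentData.data_unique D.corresponds_toStructure
  · rintro rfl
    exact S.corresponds_toCoherentData
  · exact S.corresponds_toCoherentData.data_unique h
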